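/- Let $\Phi:\mathbb C^n\to\mathbb R$ be a $C^\infty$ function such that the Hermitian matrix $H=(h_{i\bar j})$, $h_{i\bar j}=\partial_i\bar\partial_j\Phi$, is positive definite at every point (a Kähler potential of a Kähler metric on $\mathbb C^n$). Here $\partial_i=\partial/\partial z^i$, $\bar\partial_j=\partial/\partial\bar z^j$. Let $\mathcal A_c$ be the space of compactly supported complex-valued $C^\infty$ functions on $\mathbb C^n$. For smooth $f:\mathbb C^n\to\mathbb C$ and $a,b\in\mathbb C^n$ denote by $f(z+\epsilon a,\bar z+\epsilon b)$ the formal power series $\sum_{I,J}\frac{\epsilon^{|I|+|J|}}{I!\,J!}\,(\partial^I\bar\partial^J f)(z)\,a^Ib^J$ in $\epsilon$, and let $$\phi_\epsilon(z,y)=\Phi(z,\bar z+\epsilon\bar y)+\Phi(z+\epsilon y,\bar z)-\Phi(z,\bar z)-\Phi(z+\epsilon y,\bar z+\epsilon\bar y),$$ the formal expansion of the Calabi function of $\Phi$. It has the form $-\epsilon^2(Hy,y)+O(\epsilon^3)$, where $(Hy,y)=\sum_{i,j}h_{i\bar j}(z)y^i\bar y^j$. For smooth functions $f_1,f_2$ the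 non-normalized product is the formal power series in $\hbar=\epsilon^2$ $$(f_1\bullet f_2)(z)=\pi^{-n}\int_{\mathbb C^n} f_1(z,\bar z+\epsilon\bar y)\,f_2(z+\epsilon y,\bar z)\,e^{\phi_\epsilon(z,y)/\epsilon^2}\,(\det H)(z+\epsilon y,\bar z+\epsilon\bar y)\,dy,$$ where $dy$ is Lebesgue measure on $\mathbb C^n$, $f_1(z,\bar z+\epsilon\bar y)\,f_2(z+\epsilon y,\bar z)\,e^{\phi_\epsilon(z,y)/\epsilon^2+(Hy,y)}(\det H)(z+\epsilon y,\bar z+\epsilon\bar y)$ is expanded in powers of $\epsilon$, and each coefficient is integrated against $e^{-(Hy,y)}dy$; odd powers of $\epsilon$ do not occur. The product is extended $\mathbb C[[\hbar]]$-bilinearly to formal power series in $\hbar$ with smooth coefficients, by $\big(\sum_a\hbar^a f_{1,a}\big)\bullet\big(\sum_b\hbar^b f_{2,b}\big)=\sum_{a,b}\hbar^{a+b}f_{1,a}\bullet f_{2,b}$. Let $d\mu_\hbar=(\pi\hbar)^{-n}\det H\,dz$ with $dz$ Lebesgue measure on $\mathbb C^n$, and let $\tau:\mathcal A_c[[\hbar]]\to\mathbb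 C[\hbar^{-1},\hbar]]$ (formal Laurent series in $\hbar$) be the $\mathbb C[[\hbar]]$-linear functional $$\tau(f)=\int_{\mathbb C^n}f\,d\mu_\hbar ,$$ the integration being coefficientwise. **Proposition 3.10.** For all $f_1,f_2\in\mathcal A_c[[\hbar]]$, the products $f_1\bullet f_2$ and $f_2\bullet f_1$ belong to $\mathcal A_c[[\hbar]]$ and the functional $\tau$ is cyclically invariant: $\tau(f_1\bullet f_2)=\tau(f_2\bullet f_1)$. -/

import Mathlib

open scoped ContDiff ComplexOrder

noncomputable section

namespace KahlerStar

/-- The holomorphic Wirtinger derivative `∂ᵢ f = ∂f/∂zⁱ = (∂f/∂xⁱ - √-1 ∂f/∂yⁱ)/2`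
of a function on `ℂⁿ`, where `zⁱ = xⁱ + √-1 yⁱ`. -/
def dz {n : ℕ} (i : Fin n) (f : (Fin n → ℂ) → ℂ) : (Fin n → ℂ) → ℂ := fun z =>
  (fderiv ℝ f z (Pi.single i 1) - Complex.I * fderiv ℝ f z (Pi.single i Complex.I)) / 2

/-- The antiholomorphic Wirtinger derivative
`∂̄ᵢ f = ∂f/∂z̄ⁱ = (∂f/∂xⁱ + √-1 ∂f/∂yⁱ)/2`. -/
def dzbar {n : ℕ} (i : Fin n) (f : (Fin n → ℂ) → ℂ) : (Fin n → ℂ) → ℂ := fun z =>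
  (fderiv ℝ f z (Pi.single i 1) + Complex.I * fderiv ℝ f z (Pi.single i Complex.I)) / 2

/-- `∂^I f = ∂₁^{i₁} ⋯ ∂ₙ^{iₙ} f` for a multi-index `I`. -/
def dzMulti {n : ℕ} (I : Fin n → ℕ) (f : (Fin n → ℂ) → ℂ) : (Fin n → ℂ) → ℂ :=
  (List.finRange n).foldr (fun i g => (dz i)^[I i] g) f

/-- `∂̄^J f = ∂̄₁^{j₁} ⋯ ∂̄ₙ^{jₙ} f` for a multi-index `J`. -/
def dzbarMulti {n : ℕ} (J : Fin n → ℕ) (f : (Fin n → ℂ) → ℂ) : (Fin n → ℂ) → ℂ :=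
  (List.finRange n).foldr (fun j g => (dzbar j)^[J j] g) f

/-- The matrix `H = (h_{i j̄})`, `h_{i j̄} = ∂ᵢ ∂̄ⱼ Φ`, of the Kähler metric with
Kähler potential `Φ`. -/
def metricMatrix {n : ℕ} (Φ : (Fin n → ℂ) → ℝ) (z : Fin n → ℂ) : Matrix (Fin n) (Fin n) ℂ :=
  Matrix.of fun i j => dz i (dzbar j (fun v => (Φ v : ℂ))) z

/-- The determinant `det H`, as a function on `ℂⁿ`. -/
def metricDet {n : ℕ} (Φ : (Fin n → ℂ) → ℝ) : (Fin n → ℂ) → ℂ := fun z =>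
  (metricMatrix Φ z).det

/-- The formal power series in `ε` denoted by `f(z + ε a, z̄ + ε b)`, where the holomorphic
increment `a` and the antiholomorphic increment `b` are independent:
`∑_{I, J} ε^{|I| + |J|} / (I! J!) * (∂^I ∂̄^J f)(z) * a^I * b^J`.
The pair `(I, J)` is encoded as one function `K` on `Fin n ⊕ Fin n`. -/
def formalTaylor {n : ℕ} (f : (Fin n → ℂ) → ℂ) (z a b : Fin n → ℂ) : PowerSeries ℂ :=
  PowerSeries.mk fun k =>
    ∑ K ∈ Finset.piAntidiag (Finset.univ : Finset (Fin n ⊕ Fin n)) k,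
      dzMulti (fun i => K (Sum.inl i)) (dzbarMulti (fun j => K (Sum.inr j)) f) z
        / ((∏ i, ((K (Sum.inl i)).factorial : ℂ)) * ∏ j, ((K (Sum.inr j)).factorial : ℂ))
        * ((∏ i, a i ^ K (Sum.inl i)) * ∏ j, b j ^ K (Sum.inr j))

/-- The formal power series in `ε` of the Calabi function
`φ(z, z̄; v, v̄) = Φ(z, v̄) + Φ(v, z̄) - Φ(z, z̄) - Φ(v, v̄)` at `v = z + ε y`. -/
def formalCalabi {n : ℕ} (Φ : (Fin n → ℂ) → ℝ) (z y : Fin n → ℂ) : PowerSeries ℂ :=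
  formalTaylor (fun v => (Φ v : ℂ)) z 0 (star y) + formalTaylor (fun v => (Φ v : ℂ)) z y 0
    - formalTaylor (fun v => (Φ v : ℂ)) z 0 0
    - formalTaylor (fun v => (Φ v : ℂ)) z y (star y)

/-- The part of positive order in `ε` of `φ(z, z̄; z + ε y, z̄ + ε ȳ) / ε²`. (The expansion of
`φ` starts with `- ε² (H y, y)`, so that `φ / ε² = - (H y, y) + calabiTail`.) -/
def calabiTail {n : ℕ} (Φ : (Fin n → ℂ) → ℝ) (z y : Fin n → ℂ) : PowerSeries ℂ :=
  PowerSeries.mk fun k => if k = 0 then 0 else PowerSeries.coeff (k + 2) (formalCalabi Φ z y)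

/-- The exponential `∑ₘ Vᵐ / m!` of a formal power series `V` without constant term (the terms
with `m > k` do not contribute to the coefficient of order `k`). -/
def formalExp (V : PowerSeries ℂ) : PowerSeries ℂ :=
  PowerSeries.mk fun k =>
    ∑ m ∈ Finset.range (k + 1), PowerSeries.coeff k (V ^ m) / (m.factorial : ℂ)

/-- The formal power series in `ε`
`f₁(z, z̄ + ε ȳ) f₂(z + ε y, z̄) exp(φ/ε² + (H y, y)) det H(z + ε y, z̄ + ε ȳ)`,
i.e. the integrand of the formal integral after `v = z + ε y`, `ε² = ħ`, with the Gaussian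
factor `exp(- (H y, y))` taken out. -/
def formalIntegrand {n : ℕ} (Φ : (Fin n → ℂ) → ℝ) (f₁ f₂ : (Fin n → ℂ) → ℂ)
    (z y : Fin n → ℂ) : PowerSeries ℂ :=
  formalTaylor f₁ z 0 (star y) * formalTaylor f₂ z y 0 * formalExp (calabiTail Φ z y)
    * formalTaylor (metricDet Φ) z y (star y)

/-- The coefficient of `ε^k` in the formal integral
`∫ f₁(z, z̄ + ε ȳ) f₂(z + ε y, z̄) exp(φ(z, z̄; z + ε y, z̄ + ε ȳ)/ε²) dμ(y, ȳ)`, obtained by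
Gaussian integration of the coefficients of the integrand. Here
`dμ = (ω/π)ⁿ = π⁻ⁿ det H ∏ᵢ |dyⁱ ∧ dȳⁱ|/2`, and `∏ᵢ |dyⁱ ∧ dȳⁱ|/2` is Lebesgue measure. -/
def laplaceCoeff {n : ℕ} (Φ : (Fin n → ℂ) → ℝ) (k : ℕ) (f₁ f₂ : (Fin n → ℂ) → ℂ) :
    (Fin n → ℂ) → ℂ := fun z =>
  ((Real.pi : ℂ) ^ n)⁻¹ * ∫ y : Fin n → ℂ,
    PowerSeries.coeff k (formalIntegrand Φ f₁ f₂ z y)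
      * Complex.exp (-∑ i, ∑ j, metricMatrix Φ z i j * y i * star (y j))

theorem formalTaylor_neg {n : ℕ} (f : (Fin n → ℂ) → ℂ) (z a b : Fin n → ℂ) :
    formalTaylor f z (-a) (-b) = PowerSeries.rescale (-1 : ℂ) (formalTaylor f z a b) := by
  ext k
  simp only [formalTaylor, PowerSeries.coeff_mk, PowerSeries.coeff_rescale, Finset.mul_sum]
  refine Finset.sum_congr rfl fun K hK => ?_
  have hk : (∑ i, K (Sum.inl i)) + ∑ j, K (Sum.inr j) = k := by
    rw [← Fintype.sum_sum_type]; exact (Finset.mem_piAntidiag.mp hK).1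
  have h1 : (∏ i, (-a) i ^ K (Sum.inl i)) * ∏ j, (-b) j ^ K (Sum.inr j)
      = (-1) ^ k * ((∏ i, a i ^ K (Sum.inl i)) * ∏ j, b j ^ K (Sum.inr j)) := by
    have e : ∀ (c : Fin n → ℂ) (L : Fin n → ℕ),
        ∏ i, (-c) i ^ L i = (-1) ^ (∑ i, L i) * ∏ i, c i ^ L i := by
      intro c L
      rw [← Finset.prod_pow_eq_pow_sum, ← Finset.prod_mul_distrib]
      exact Finset.prod_congr rfl fun i _ => by rw [Pi.neg_apply, neg_pow]
    rw [e, e, ← hk, pow_add]; ring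
  rw [h1]; ring

theorem formalExp_rescale (V : PowerSeries ℂ) :
    formalExp (PowerSeries.rescale (-1 : ℂ) V) = PowerSeries.rescale (-1 : ℂ) (formalExp V) := by
  ext k
  simp only [formalExp, PowerSeries.coeff_mk, PowerSeries.coeff_rescale, Finset.mul_sum,
    ← map_pow, mul_div_assoc]

theorem formalIntegrand_neg {n : ℕ} (Φ : (Fin n → ℂ) → ℝ) (f₁ f₂ : (Fin n → ℂ) → ℂ)
    (z y : Fin n → ℂ) :
    formalIntegrand Φ f₁ f₂ z (-y)
      = PowerSeries.rescale (-1 : ℂ) (formalIntegrand Φ f₁ f₂ z y) := by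
  have h0 : ∀ (f : (Fin n → ℂ) → ℂ) (a : Fin n → ℂ),
      formalTaylor f z (-a) 0 = PowerSeries.rescale (-1 : ℂ) (formalTaylor f z a 0) := by
    intro f a; simpa using formalTaylor_neg f z a 0
  have h1 : ∀ (f : (Fin n → ℂ) → ℂ) (b : Fin n → ℂ),
      formalTaylor f z 0 (-b) = PowerSeries.rescale (-1 : ℂ) (formalTaylor f z 0 b) := by
    intro f b; simpa using formalTaylor_neg f z 0 b
  have h2 : ∀ (f : (Fin n → ℂ) → ℂ),
      formalTaylor f z 0 0 = PowerSeries.rescale (-1 : ℂ) (formalTaylor f z 0 0) := by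
    intro f; simpa using formalTaylor_neg f z 0 0
  have hc : formalCalabi Φ z (-y) = PowerSeries.rescale (-1 : ℂ) (formalCalabi Φ z y) := by
    simp only [formalCalabi, star_neg, map_add, map_sub, h0, h1, formalTaylor_neg, ← h2]
  have hV : calabiTail Φ z (-y) = PowerSeries.rescale (-1 : ℂ) (calabiTail Φ z y) := by
    ext k
    simp only [calabiTail, PowerSeries.coeff_mk, PowerSeries.coeff_rescale, hc]
    split_ifs
    · simp
    · rw [pow_add]; simp
  simp only [formalIntegrand, star_neg, map_mul, h0, h1, formalTaylor_neg, hV, formalExp_rescale]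

/-- The odd powers of `ε` do not occur, so that the formal integral is a formal power series in
`ħ = ε²`. -/
theorem laplaceCoeff_odd {n : ℕ} (Φ : (Fin n → ℂ) → ℝ) (k : ℕ) (f₁ f₂ : (Fin n → ℂ) → ℂ) :
    laplaceCoeff Φ (2 * k + 1) f₁ f₂ = 0 := by
  funext z
  have h := MeasureTheory.integral_neg_eq_self (fun y : Fin n → ℂ =>
    PowerSeries.coeff (2 * k + 1) (formalIntegrand Φ f₁ f₂ z y)
      * Complex.exp (-∑ i, ∑ j, metricMatrix Φ z i j * y i * star (y j))) MeasureTheory.volume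
  simp only [formalIntegrand_neg, PowerSeries.coeff_rescale, Pi.neg_apply, star_neg, mul_neg,
    neg_mul, neg_neg, Odd.neg_one_pow ⟨k, rfl⟩, one_mul, MeasureTheory.integral_neg] at h
  rw [laplaceCoeff, self_eq_neg.mp h.symm]
  simp

/-- The non-normalized product `f₁ • f₂` on formal power series in `ħ` whose coefficients are
functions on `ℂⁿ`: for functions `f₁`, `f₂` the coefficient of `ħ^c = ε^{2c}` is the one of the
formal integral, and the product is extended `ℂ[[ħ]]`-bilinearly,
`(∑ ħ^a f₁ₐ) • (∑ ħ^b f₂ᵦ) = ∑ ħ^{a+b} (f₁ₐ • f₂ᵦ)`. -/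
def bullet {n : ℕ} (Φ : (Fin n → ℂ) → ℝ) (f₁ f₂ : PowerSeries ((Fin n → ℂ) → ℂ)) :
    PowerSeries ((Fin n → ℂ) → ℂ) :=
  PowerSeries.mk fun m =>
    ∑ p ∈ Finset.HasAntidiagonal.antidiagonal m, ∑ q ∈ Finset.HasAntidiagonal.antidiagonal p.1,
      laplaceCoeff Φ (2 * p.2) (PowerSeries.coeff q.1 f₁) (PowerSeries.coeff q.2 f₂)

/-- `A_c[[ħ]]`: formal power series in `ħ` whose coefficients are complex valued `C^∞` functions
with compact support on `ℂⁿ`. -/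
def compactlySupportedSeries (n : ℕ) : Set (PowerSeries ((Fin n → ℂ) → ℂ)) :=
  {f | ∀ k, ContDiff ℝ ∞ (PowerSeries.coeff k f) ∧ HasCompactSupport (PowerSeries.coeff k f)}

/-- The functional `τ(f) = ∫ f dμ_ħ`, `dμ_ħ = (ω/(πħ))ⁿ = (πħ)⁻ⁿ det H · (Lebesgue measure)`,
as a formal Laurent series in `ħ`; the integration is coefficientwise. -/
def tau {n : ℕ} (Φ : (Fin n → ℂ) → ℝ) (f : PowerSeries ((Fin n → ℂ) → ℂ)) : LaurentSeries ℂ :=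
  HahnSeries.single (-(n : ℤ)) (((Real.pi : ℂ) ^ n)⁻¹)
    * HahnSeries.ofPowerSeries ℤ ℂ (PowerSeries.mk fun k =>
        ∫ z : Fin n → ℂ, PowerSeries.coeff k f z * metricDet Φ z)

end KahlerStar

end

noncomputable section

namespace KahlerStar

section FormalFlow

open PowerSeries Finset

variable {R : Type*} [CommRing R] [Algebra ℂ R]

/-- A derivation of `R` acting on the coefficients of a power series over `R`. -/
def coeffDeriv (D : Derivation ℂ R R) (A : PowerSeries R) : PowerSeries R :=
  PowerSeries.mk fun k => D (coeff k A)

/-- The operator `exp (ε D)` on power series in `ε` over `R`. -/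
def flow (D : Derivation ℂ R R) (A : PowerSeries R) : PowerSeries R :=
  PowerSeries.mk fun k => ∑ p ∈ antidiagonal k,
    ((p.1.factorial : ℂ)⁻¹) • (((D : R →ₗ[ℂ] R) ^ p.1) (coeff p.2 A))

@[simp] theorem coeff_coeffDeriv (D : Derivation ℂ R R) (A : PowerSeries R) (k : ℕ) :
    coeff k (coeffDeriv D A) = D (coeff k A) := coeff_mk _ _

@[simp] theorem constantCoeff_coeffDeriv (D : Derivation ℂ R R) (A : PowerSeries R) :
    constantCoeff (coeffDeriv D A) = D (constantCoeff A) := by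
  rw [← coeff_zero_eq_constantCoeff_apply, coeff_coeffDeriv, coeff_zero_eq_constantCoeff_apply]

theorem coeff_flow (D : Derivation ℂ R R) (A : PowerSeries R) (k : ℕ) :
    coeff k (flow D A) = ∑ p ∈ antidiagonal k,
      ((p.1.factorial : ℂ)⁻¹) • (((D : R →ₗ[ℂ] R) ^ p.1) (coeff p.2 A)) := coeff_mk _ _

theorem coeff_flow_C (D : Derivation ℂ R R) (f : R) (k : ℕ) :
    coeff k (flow D (C f)) = ((k.factorial : ℂ)⁻¹) • (((D : R →ₗ[ℂ] R) ^ k) f) := by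
  rw [coeff_flow, Finset.sum_eq_single (k, 0)]
  · simp
  · rintro ⟨i, j⟩ hij hne
    have : j ≠ 0 := by
      rintro rfl
      apply hne
      simpa using hij
    simp [coeff_C, this]
  · simp

@[simp] theorem constantCoeff_flow (D : Derivation ℂ R R) (A : PowerSeries R) :
    constantCoeff (flow D A) = constantCoeff A := by
  rw [← coeff_zero_eq_constantCoeff_apply, coeff_flow]; simp

theorem coeffDeriv_add (D : Derivation ℂ R R) (A B : PowerSeries R) :
    coeffDeriv D (A + B) = coeffDeriv D A + coeffDeriv D B := by
  ext k; simp

theorem coeffDeriv_sub (D : Derivation ℂ R R) (A B : PowerSeries R) :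
    coeffDeriv D (A - B) = coeffDeriv D A - coeffDeriv D B := by
  ext k; simp

theorem coeffDeriv_mul (D : Derivation ℂ R R) (A B : PowerSeries R) :
    coeffDeriv D (A * B) = coeffDeriv D A * B + A * coeffDeriv D B := by
  ext k
  simp only [coeff_coeffDeriv, coeff_mul, map_sum, map_add, ← Finset.sum_add_distrib]
  refine Finset.sum_congr rfl fun p _ => ?_
  simp only [Derivation.leibniz, smul_eq_mul]
  ring

theorem derivative_coeffDeriv (D : Derivation ℂ R R) (A : PowerSeries R) :
    derivative R (coeffDeriv D A) = coeffDeriv D (derivative R A) := by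
  ext k
  have : ((k : R) + 1) = ((k + 1 : ℕ) : R) := by push_cast; ring
  simp only [coeff_derivative, coeff_coeffDeriv, this, Derivation.leibniz, Derivation.map_natCast,
    smul_eq_mul]
  ring

theorem flow_add (D : Derivation ℂ R R) (A B : PowerSeries R) :
    flow D (A + B) = flow D A + flow D B := by
  ext k; simp [coeff_flow, Finset.sum_add_distrib]

theorem flow_sub (D : Derivation ℂ R R) (A B : PowerSeries R) :
    flow D (A - B) = flow D A - flow D B := by
  ext k; simp [coeff_flow, smul_sub, Finset.sum_sub_distrib]

theorem coeffDeriv_flow {D D' : Derivation ℂ R R}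
    (h : Commute (D : R →ₗ[ℂ] R) (D' : R →ₗ[ℂ] R)) (A : PowerSeries R) :
    coeffDeriv D' (flow D A) = flow D (coeffDeriv D' A) := by
  ext k
  simp only [coeff_coeffDeriv, coeff_flow, map_sum, Derivation.map_smul]
  refine Finset.sum_congr rfl fun p _ => ?_
  congr 1
  have := congrArg (fun T : R →ₗ[ℂ] R => T (coeff p.2 A)) (h.pow_left p.1).eq
  simpa [Module.End.mul_apply] using this.symm

theorem flow_eq_self {D : Derivation ℂ R R} {A : PowerSeries R} (h : coeffDeriv D A = 0) :
    flow D A = A := by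
  ext k
  rw [coeff_flow, Finset.sum_eq_single (0, k)]
  · simp
  · rintro ⟨i, j⟩ hij hne
    obtain ⟨i, rfl⟩ : ∃ i', i = i' + 1 := by
      refine Nat.exists_eq_succ_of_ne_zero ?_
      rintro rfl
      apply hne
      simpa using hij
    have hj : D (coeff j A) = 0 := by rw [← coeff_coeffDeriv, h]; simp
    simp [pow_succ, Module.End.mul_apply, hj]
  · simp

theorem derivative_flow (D : Derivation ℂ R R) (A : PowerSeries R) :
    derivative R (flow D A) = flow D (derivative R A) + coeffDeriv D (flow D A) := by
  ext k
  simp only [coeff_derivative, map_add, coeff_coeffDeriv, coeff_flow]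
  have hc : ((k : R) + 1) = algebraMap ℂ R ((k : ℂ) + 1) := by simp
  rw [hc, mul_comm, ← Algebra.smul_def, Finset.smul_sum]
  have hsplit : ∀ p ∈ antidiagonal (k + 1),
      ((k : ℂ) + 1) • ((p.1.factorial : ℂ)⁻¹) • (((D : R →ₗ[ℂ] R) ^ p.1) (coeff p.2 A))
        = ((p.1.factorial : ℂ)⁻¹) • (((D : R →ₗ[ℂ] R) ^ p.1) ((p.2 : ℂ) • coeff p.2 A))
          + ((p.1 : ℂ) * (p.1.factorial : ℂ)⁻¹) • (((D : R →ₗ[ℂ] R) ^ p.1) (coeff p.2 A)) := by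
    intro p hp
    have : (k : ℂ) + 1 = p.1 + p.2 := by
      rw [HasAntidiagonal.mem_antidiagonal] at hp; exact_mod_cast hp.symm
    rw [this, map_smul, smul_smul, smul_smul, ← add_smul]
    congr 1; ring
  rw [Finset.sum_congr rfl hsplit, Finset.sum_add_distrib]
  congr 1
  · rw [Finset.Nat.sum_antidiagonal_succ']
    simp only [Nat.cast_zero, zero_smul, map_zero, smul_zero, zero_add]
    refine Finset.sum_congr rfl fun p _ => ?_
    congr 2
    rw [Algebra.smul_def, mul_comm]
    simp
  · rw [Finset.Nat.sum_antidiagonal_succ]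
    simp only [Nat.cast_zero, zero_mul, zero_smul, zero_add, map_sum, Derivation.map_smul]
    refine Finset.sum_congr rfl fun p _ => ?_
    have hp : ((p.1 : ℂ) + 1) ≠ 0 := Nat.cast_add_one_ne_zero _
    congr 1
    · rw [Nat.factorial_succ]; push_cast; field_simp
    · rw [pow_succ']; rfl


/-- A power series is determined by its constant term and the vanishing of the lower-order part of
its derivative. -/
theorem coeff_succ_eq_zero_of_derivative {A : PowerSeries R} {k : ℕ}
    (h : coeff k (derivative R A) = 0) : coeff (k + 1) A = 0 := by
  rw [coeff_derivative] at h
  have hc : ((k : R) + 1) = algebraMap ℂ R ((k : ℂ) + 1) := by simp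
  rw [hc, mul_comm, ← Algebra.smul_def] at h
  have := congrArg (fun x => ((k : ℂ) + 1)⁻¹ • x) h
  simpa [smul_smul, inv_mul_cancel₀ (Nat.cast_add_one_ne_zero k : (k : ℂ) + 1 ≠ 0)] using this

/-- Uniqueness for the formal linear evolution equation `∂A/∂ε = D A + F A`. -/
theorem eq_zero_of_evolution (D : Derivation ℂ R R) (F : PowerSeries R) {A : PowerSeries R}
    (h0 : constantCoeff A = 0) (h : derivative R A = coeffDeriv D A + F * A) : A = 0 := by
  ext k
  induction k using Nat.strong_induction_on with
  | _ k ih =>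
    cases k with
    | zero => simpa using h0
    | succ k =>
      rw [map_zero]
      apply coeff_succ_eq_zero_of_derivative
      rw [h, map_add, coeff_coeffDeriv, ih k (Nat.lt_succ_self k), coeff_mul]
      simp only [map_zero, zero_add]
      refine Finset.sum_eq_zero fun p hp => ?_
      have := HasAntidiagonal.mem_antidiagonal.mp hp
      rw [ih p.2 (by omega)]; simp

theorem eq_of_evolution (D : Derivation ℂ R R) (F : PowerSeries R) {A B : PowerSeries R}
    (h0 : constantCoeff A = constantCoeff B) (hA : derivative R A = coeffDeriv D A + F * A)
    (hB : derivative R B = coeffDeriv D B + F * B) : A = B := by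
  rw [← sub_eq_zero]
  refine eq_zero_of_evolution D F (by rw [map_sub, h0, sub_self]) ?_
  rw [map_sub, hA, hB, coeffDeriv_sub]; ring

theorem flow_mul (D : Derivation ℂ R R) (A B : PowerSeries R) :
    flow D (A * B) = flow D A * flow D B := by
  ext k
  induction k generalizing A B with
  | zero => simp
  | succ k ih =>
    rw [← sub_eq_zero, ← map_sub]
    apply coeff_succ_eq_zero_of_derivative
    have : derivative R (flow D (A * B) - flow D A * flow D B)
        = coeffDeriv D (flow D (A * B) - flow D A * flow D B)
          + (flow D (A * derivative R B) - flow D A * flow D (derivative R B))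
          + (flow D (B * derivative R A) - flow D B * flow D (derivative R A)) := by
      rw [map_sub, Derivation.leibniz, derivative_flow, derivative_flow, derivative_flow,
        Derivation.leibniz, coeffDeriv_sub, coeffDeriv_mul, flow_add]
      simp only [smul_eq_mul]
      ring
    rw [this, map_add, map_add, coeff_coeffDeriv, map_sub, map_sub, map_sub, map_sub, ih A B,
      ih A, ih B]
    simp

@[simp] theorem coeffDeriv_C (D : Derivation ℂ R R) (f : R) :
    coeffDeriv D (C f) = C (D f) := by
  ext k; simp only [coeff_coeffDeriv, coeff_C]; split_ifs <;> simp

theorem derivative_flow_C (D : Derivation ℂ R R) (f : R) :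
    derivative R (flow D (C f)) = coeffDeriv D (flow D (C f)) := by
  rw [derivative_flow, derivative_C]
  ext k; simp [coeff_flow]

theorem flow_flow_C {D D' : Derivation ℂ R R}
    (h : Commute (D : R →ₗ[ℂ] R) (D' : R →ₗ[ℂ] R)) (f : R) :
    flow D (flow D' (C f)) = flow (D + D') (C f) := by
  refine eq_of_evolution (D + D') 0 (by simp) ?_ ?_
  · rw [derivative_flow, derivative_flow_C, ← coeffDeriv_flow h]
    ext k; simp [add_comm]
  · rw [derivative_flow_C]; simp

theorem flow_zero_C (f : R) : flow (0 : Derivation ℂ R R) (C f) = C f :=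
  flow_eq_self (by simp)

theorem flow_X_sq_mul (D : Derivation ℂ R R) (A : PowerSeries R) :
    flow D (X ^ 2 * A) = X ^ 2 * flow D A := by
  rw [flow_mul, flow_eq_self]
  ext k
  simp only [coeff_coeffDeriv, coeff_X_pow]
  split_ifs <;> simp

/-- The exponential of a power series without constant term. -/
def seriesExp (V : PowerSeries R) : PowerSeries R :=
  PowerSeries.mk fun k => ∑ m ∈ range (k + 1), ((m.factorial : ℂ)⁻¹) • coeff k (V ^ m)

theorem coeff_seriesExp {V : PowerSeries R} (hV : constantCoeff V = 0) {k N : ℕ} (hN : k < N) :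
    coeff k (seriesExp V) = coeff k (∑ m ∈ range N, ((m.factorial : ℂ)⁻¹) • V ^ m) := by
  rw [seriesExp, coeff_mk, map_sum]
  simp only [coeff_smul]
  refine Finset.sum_subset (Finset.range_subset_range.mpr hN) fun m _ hm => ?_
  have hkm : k < m := by simpa using hm
  rw [coeff_of_lt_order, smul_zero]
  refine lt_of_lt_of_le (Nat.cast_lt.mpr hkm) (le_order_pow_of_constantCoeff_eq_zero m ?_)
  simpa using hV

@[simp] theorem constantCoeff_seriesExp (V : PowerSeries R) : constantCoeff (seriesExp V) = 1 := by
  rw [← coeff_zero_eq_constantCoeff_apply, seriesExp, coeff_mk]; simp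

theorem derivative_seriesExp {V : PowerSeries R} (hV : constantCoeff V = 0) :
    derivative R (seriesExp V) = derivative R V * seriesExp V := by
  have hd : ∀ N, derivative R (∑ m ∈ range (N + 1), ((m.factorial : ℂ)⁻¹) • V ^ m)
      = derivative R V * ∑ m ∈ range N, ((m.factorial : ℂ)⁻¹) • V ^ m := by
    intro N
    rw [map_sum, Finset.sum_range_succ', Finset.mul_sum]
    have h0 : derivative R (((Nat.factorial 0 : ℂ)⁻¹) • V ^ 0) = 0 := by simp
    rw [h0, add_zero]
    refine Finset.sum_congr rfl fun m _ => ?_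
    have hs : ∀ (c : ℂ) (A : PowerSeries R), derivative R (c • A) = c • derivative R A := by
      intro c A; ext k; simp [coeff_derivative]
    rw [hs, Derivation.leibniz_pow]
    simp only [Nat.add_sub_cancel, smul_eq_mul, mul_smul_comm]
    rw [← Nat.cast_smul_eq_nsmul ℂ, smul_smul, mul_comm (derivative R V)]
    congr 1
    have hp : ((m : ℂ) + 1) ≠ 0 := Nat.cast_add_one_ne_zero _
    rw [Nat.factorial_succ]; push_cast; field_simp
  ext k
  rw [coeff_derivative, coeff_seriesExp hV (Nat.lt_succ_self (k + 1)), ← coeff_derivative, hd,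
    coeff_mul, coeff_mul]
  refine Finset.sum_congr rfl fun p hp => ?_
  have := HasAntidiagonal.mem_antidiagonal.mp hp
  rw [coeff_seriesExp hV (N := k + 1) (by omega)]

theorem coeffDeriv_seriesExp (D : Derivation ℂ R R) {V : PowerSeries R} (hV : constantCoeff V = 0) :
    coeffDeriv D (seriesExp V) = coeffDeriv D V * seriesExp V := by
  rw [← sub_eq_zero]
  refine eq_zero_of_evolution (0 : Derivation ℂ R R) (derivative R V) ?_ ?_
  · rw [map_sub, map_mul, constantCoeff_coeffDeriv, constantCoeff_coeffDeriv,
      constantCoeff_seriesExp, hV]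
    simp
  · rw [map_sub, derivative_coeffDeriv, derivative_seriesExp hV, coeffDeriv_mul,
      Derivation.leibniz, derivative_seriesExp hV, derivative_coeffDeriv]
    have : coeffDeriv (0 : Derivation ℂ R R) (coeffDeriv D (seriesExp V)
      - coeffDeriv D V * seriesExp V) = 0 := by ext k; simp
    rw [this]
    simp only [smul_eq_mul]
    ring

/-- The flow of a derivation `D` is compatible with exponentials: if `e` and `e'` play the role of
the exponentials of `p` and `p'`, then `exp (ε D)` sends `e · exp V` to `e' · exp V'` as soon as it
sends `p + V` to `p' + V'`. -/
theorem flow_exp (D : Derivation ℂ R R) {p e : R} {V V' : PowerSeries R}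
    (hV : constantCoeff V = 0) (hV' : constantCoeff V' = 0) (he : D e = D p * e)
    (h : flow D (C p + V) = C p + V') :
    flow D (C e * seriesExp V) = C e * seriesExp V' := by
  refine eq_of_evolution 0 (derivative R V') ?_ ?_ ?_
  · simp
  · have hd := derivative_flow D (C p + V)
    rw [h, map_add, map_add, derivative_C, zero_add, zero_add, ← h, coeffDeriv_flow (.refl _),
      ← flow_add] at hd
    have h0 : coeffDeriv (0 : Derivation ℂ R R) (flow D (C e * seriesExp V)) = 0 := by
      ext k; simp
    rw [derivative_flow, coeffDeriv_flow (.refl _), ← flow_add, h0, zero_add, hd, ← flow_mul,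
      Derivation.leibniz, derivative_C, coeffDeriv_mul, derivative_seriesExp hV,
      coeffDeriv_seriesExp D hV, coeffDeriv_add, coeffDeriv_C, coeffDeriv_C, he, map_mul]
    congr 1
    simp only [smul_eq_mul]
    ring
  · have h0 : coeffDeriv (0 : Derivation ℂ R R) (C e * seriesExp V') = 0 := by
      ext k; simp
    rw [h0, Derivation.leibniz, derivative_C, derivative_seriesExp hV']
    simp only [smul_eq_mul]
    ring

section Calabi

/-- The formal Calabi function of `φ` for the displacement derivations `D`, `D'`. -/
def calabiSeries (D D' : Derivation ℂ R R) (φ : R) : PowerSeries R :=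
  flow D' (C φ) + flow D (C φ) - C φ - flow (D + D') (C φ)

/-- The part of positive order of `calabiSeries D D' φ / ε²`. -/
def calabiTailSeries (D D' : Derivation ℂ R R) (φ : R) : PowerSeries R :=
  PowerSeries.mk fun k => if k = 0 then 0 else coeff (k + 2) (calabiSeries D D' φ)

/-- The formal integrand for the displacement derivations `D`, `D'`. -/
def integrandSeries (D D' : Derivation ℂ R R) (φ d g₁ g₂ : R) : PowerSeries R :=
  flow D' (C g₁) * flow D (C g₂) * seriesExp (calabiTailSeries D D' φ) * flow (D + D') (C d)

theorem constantCoeff_calabiTailSeries (D D' : Derivation ℂ R R) (φ : R) :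
    constantCoeff (calabiTailSeries D D' φ) = 0 := by
  rw [← coeff_zero_eq_constantCoeff_apply]; simp [calabiTailSeries]

theorem X_sq_mul_cancel {S : Type*} [CommRing S] {A B : PowerSeries S}
    (h : X ^ 2 * A = X ^ 2 * B) : A = B := by
  ext k
  rw [← coeff_X_pow_mul A 2 k, h, coeff_X_pow_mul]

variable {D D' : Derivation ℂ R R}

theorem calabiSeries_eq (h : Commute (D : R →ₗ[ℂ] R) (D' : R →ₗ[ℂ] R)) (φ : R) :
    calabiSeries D D' φ = X ^ 2 * (C (-D (D' φ)) + calabiTailSeries D D' φ) := by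
  have hcomm := congrArg (fun T : R →ₗ[ℂ] R => T φ) h.eq
  simp only [Module.End.mul_apply, Derivation.coeFn_coe] at hcomm
  ext1 k
  rcases k with _ | _ | k
  · simp [calabiSeries]
  · rw [coeff_X_pow_mul']
    simp [calabiSeries, coeff_flow_C]
    ring
  · change coeff (k + 2) _ = coeff (k + 2) _
    rw [coeff_X_pow_mul, map_add]
    rcases k with _ | k
    · have h2 : ∀ E : Derivation ℂ R R,
          coeff 2 (flow E (C φ)) = (2⁻¹ : ℂ) • E (E φ) := by
        intro E
        rw [coeff_flow_C]; simp [pow_two]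
      have h3 : coeff 2 (C φ : PowerSeries R) = 0 := by simp
      have h4 : coeff 0 (calabiTailSeries D D' φ) = 0 := by simp [calabiTailSeries]
      rw [zero_add, calabiSeries, map_sub, map_sub, map_add, h2, h2, h2, h3, h4,
        coeff_zero_C, Derivation.add_apply, Derivation.add_apply, map_add, map_add, ← hcomm]
      module
    · simp [calabiTailSeries]

theorem commute_add_neg (h : Commute (D : R →ₗ[ℂ] R) (D' : R →ₗ[ℂ] R)) :
    Commute ((D + D' : Derivation ℂ R R) : R →ₗ[ℂ] R) ((-D : Derivation ℂ R R) : R →ₗ[ℂ] R) ∧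
    Commute ((D + D' : Derivation ℂ R R) : R →ₗ[ℂ] R) ((-D' : Derivation ℂ R R) : R →ₗ[ℂ] R) ∧
    Commute ((D + D' : Derivation ℂ R R) : R →ₗ[ℂ] R)
      ((-D + -D' : Derivation ℂ R R) : R →ₗ[ℂ] R) := by
  have hD : Commute ((D + D' : Derivation ℂ R R) : R →ₗ[ℂ] R)
      ((-D : Derivation ℂ R R) : R →ₗ[ℂ] R) := by
    rw [Derivation.coe_neg_linearMap, Derivation.coe_add_linearMap]
    exact ((Commute.refl _).add_left h.symm).neg_right
  have hD' : Commute ((D + D' : Derivation ℂ R R) : R →ₗ[ℂ] R)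
      ((-D' : Derivation ℂ R R) : R →ₗ[ℂ] R) := by
    rw [Derivation.coe_neg_linearMap, Derivation.coe_add_linearMap]
    exact (h.add_left (Commute.refl _)).neg_right
  have hDD' : Commute ((D + D' : Derivation ℂ R R) : R →ₗ[ℂ] R)
      ((-D + -D' : Derivation ℂ R R) : R →ₗ[ℂ] R) := by
    rw [Derivation.coe_add_linearMap (-D)]
    exact hD.add_right hD'
  exact ⟨hD, hD', hDD'⟩

theorem flow_calabiSeries_neg (h : Commute (D : R →ₗ[ℂ] R) (D' : R →ₗ[ℂ] R)) (φ : R) :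
    flow (D + D') (calabiSeries (-D) (-D') φ) = calabiSeries D D' φ := by
  obtain ⟨hD, hD', hDD'⟩ := commute_add_neg h
  rw [calabiSeries, flow_sub, flow_sub, flow_add, flow_flow_C hD, flow_flow_C hD',
    flow_flow_C hDD', calabiSeries, show D + D' + -D' = D by abel, show D + D' + -D = D' by abel,
    show D + D' + (-D + -D') = 0 by abel, flow_zero_C]
  ring

/-- Exchanging the two points in the formal integrand amounts to a formal translation of the base
point; here `e` plays the role of the exponential of `- D (D' φ)`. -/
theorem flow_integrandSeries_neg (h : Commute (D : R →ₗ[ℂ] R) (D' : R →ₗ[ℂ] R)) {φ e : R}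
    (he : (D + D') e = (D + D') (-D (D' φ)) * e) (d g₁ g₂ : R) :
    flow (D + D') (integrandSeries (-D) (-D') φ d g₂ g₁ * C e * C d)
      = integrandSeries D D' φ d g₁ g₂ * C e * C d := by
  obtain ⟨hD, hD', hDD'⟩ := commute_add_neg h
  have hneg : Commute ((-D : Derivation ℂ R R) : R →ₗ[ℂ] R)
      ((-D' : Derivation ℂ R R) : R →ₗ[ℂ] R) := by
    rw [Derivation.coe_neg_linearMap, Derivation.coe_neg_linearMap]
    exact h.neg_left.neg_right
  have hexp : flow (D + D') (C e * seriesExp (calabiTailSeries (-D) (-D') φ))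
      = C e * seriesExp (calabiTailSeries D D' φ) := by
    refine flow_exp _ (constantCoeff_calabiTailSeries _ _ _)
      (constantCoeff_calabiTailSeries _ _ _) he (X_sq_mul_cancel ?_)
    have hq : (-D) ((-D') φ) = D (D' φ) := by simp
    rw [← flow_X_sq_mul, ← calabiSeries_eq h, ← flow_calabiSeries_neg h, calabiSeries_eq hneg, hq]
  have h1 : integrandSeries (-D) (-D') φ d g₂ g₁ * C e * C d
      = flow (-D') (C g₂) * flow (-D) (C g₁) * (C e * seriesExp (calabiTailSeries (-D) (-D') φ))
        * flow (-D + -D') (C d) * C d := by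
    rw [integrandSeries]; ring
  rw [h1, flow_mul, flow_mul, flow_mul, flow_mul, hexp, flow_flow_C hD, flow_flow_C hD',
    flow_flow_C hDD', integrandSeries, show D + D' + -D' = D by abel,
    show D + D' + -D = D' by abel, show D + D' + (-D + -D') = 0 by abel, flow_zero_C]
  ring

end Calabi

end FormalFlow

open MeasureTheory

section GaussianIntegrals

variable {n : ℕ}

theorem contDiff_fderiv_apply {f : (Fin n → ℂ) → ℂ} (hf : ContDiff ℝ ∞ f) (v : Fin n → ℂ) :
    ContDiff ℝ ∞ fun z => fderiv ℝ f z v :=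
  (hf.fderiv_right (m := ∞) (by simp)).clm_apply contDiff_const

theorem contDiff_dz (i : Fin n) {f : (Fin n → ℂ) → ℂ} (hf : ContDiff ℝ ∞ f) :
    ContDiff ℝ ∞ (dz i f) :=
  ((contDiff_fderiv_apply hf _).sub
    (contDiff_const.mul (contDiff_fderiv_apply hf _))).div_const 2

theorem contDiff_dzbar (i : Fin n) {f : (Fin n → ℂ) → ℂ} (hf : ContDiff ℝ ∞ f) :
    ContDiff ℝ ∞ (dzbar i f) :=
  ((contDiff_fderiv_apply hf _).add
    (contDiff_const.mul (contDiff_fderiv_apply hf _))).div_const 2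

theorem contDiff_ofReal_comp {Φ : (Fin n → ℂ) → ℝ} (hΦ : ContDiff ℝ ∞ Φ) :
    ContDiff ℝ ∞ fun v => (Φ v : ℂ) :=
  Complex.ofRealCLM.contDiff.comp hΦ

theorem contDiff_metricMatrix {Φ : (Fin n → ℂ) → ℝ} (hΦ : ContDiff ℝ ∞ Φ) (i j : Fin n) :
    ContDiff ℝ ∞ fun z => metricMatrix Φ z i j :=
  contDiff_dz i (contDiff_dzbar j (contDiff_ofReal_comp hΦ))

theorem contDiff_metricDet {Φ : (Fin n → ℂ) → ℝ} (hΦ : ContDiff ℝ ∞ Φ) :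
    ContDiff ℝ ∞ (metricDet Φ) := by
  unfold metricDet
  simp only [Matrix.det_apply]
  refine ContDiff.sum fun σ _ => ContDiff.const_smul _ ?_
  exact contDiff_prod fun i _ => contDiff_metricMatrix hΦ _ _

/-- The Hermitian form `(H y, y)`. -/
def metricForm (Φ : (Fin n → ℂ) → ℝ) (z y : Fin n → ℂ) : ℂ :=
  ∑ i, ∑ j, metricMatrix Φ z i j * y i * star (y j)

theorem continuous_metricForm {Φ : (Fin n → ℂ) → ℝ} (hΦ : ContDiff ℝ ∞ Φ) :
    Continuous fun p : (Fin n → ℂ) × (Fin n → ℂ) => metricForm Φ p.1 p.2 := by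
  unfold metricForm
  refine continuous_finsetSum _ fun i _ => continuous_finsetSum _ fun j _ => ?_
  have := (contDiff_metricMatrix hΦ i j).continuous
  fun_prop

theorem continuous_metricForm_right (Φ : (Fin n → ℂ) → ℝ) (z : Fin n → ℂ) :
    Continuous fun y => metricForm Φ z y := by
  unfold metricForm
  fun_prop

theorem metricForm_pos {Φ : (Fin n → ℂ) → ℝ} {z : Fin n → ℂ} (hpos : (metricMatrix Φ z).PosDef)
    {y : Fin n → ℂ} (hy : y ≠ 0) : 0 < (metricForm Φ z y).re := by
  have h := hpos.dotProduct_mulVec_pos (x := star y) (by simpa using hy)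
  have he : dotProduct (star (star y)) ((metricMatrix Φ z).mulVec (star y)) = metricForm Φ z y := by
    simp only [dotProduct, Matrix.mulVec, metricForm, Finset.mul_sum, star_star, Pi.star_apply]
    refine Finset.sum_congr rfl fun i _ => Finset.sum_congr rfl fun j _ => ?_
    ring
  rw [he] at h
  exact (Complex.lt_def.mp h).1

theorem metricForm_smul (Φ : (Fin n → ℂ) → ℝ) (z : Fin n → ℂ) (r : ℝ) (y : Fin n → ℂ) :
    metricForm Φ z (r • y) = (r : ℂ) ^ 2 * metricForm Φ z y := by
  simp only [metricForm, Finset.mul_sum, Pi.smul_apply, Complex.real_smul, star_mul',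
    Complex.star_def, Complex.conj_ofReal]
  refine Finset.sum_congr rfl fun i _ => Finset.sum_congr rfl fun j _ => ?_
  ring

theorem exists_le_metricForm {Φ : (Fin n → ℂ) → ℝ} (hΦ : ContDiff ℝ ∞ Φ)
    (hpos : ∀ z, (metricMatrix Φ z).PosDef) {K : Set (Fin n → ℂ)} (hK : IsCompact K) :
    ∃ c : ℝ, 0 < c ∧ ∀ z ∈ K, ∀ y, c * ‖y‖ ^ 2 ≤ (metricForm Φ z y).re := by
  have hcont : Continuous fun p : (Fin n → ℂ) × (Fin n → ℂ) => (metricForm Φ p.1 p.2).re :=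
    Complex.continuous_re.comp (continuous_metricForm hΦ)
  have hlt : ∀ p ∈ K ×ˢ Metric.sphere (0 : Fin n → ℂ) 1, 0 < (metricForm Φ p.1 p.2).re := by
    rintro ⟨z, y⟩ ⟨-, hy⟩
    refine metricForm_pos (hpos z) ?_
    rintro rfl
    simp at hy
  obtain ⟨c, hc, hle⟩ := (hK.prod (isCompact_sphere (0 : Fin n → ℂ) 1)).exists_forall_le'
    hcont.continuousOn hlt
  refine ⟨c, hc, fun z hz y => ?_⟩
  by_cases hy : y = 0
  · simp [hy, metricForm]
  have hy' : ‖y‖ ≠ 0 := norm_ne_zero_iff.mpr hy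
  have h1 := hle (z, ‖y‖⁻¹ • y) ⟨hz, by simp [norm_smul, hy']⟩
  have h2 : metricForm Φ z y = (‖y‖ : ℂ) ^ 2 * metricForm Φ z (‖y‖⁻¹ • y) := by
    rw [← metricForm_smul, smul_smul, mul_inv_cancel₀ hy', one_smul]
  rw [h2, ← Complex.ofReal_pow, Complex.re_ofReal_mul, mul_comm c]
  exact mul_le_mul_of_nonneg_left h1 (by positivity)

theorem integrable_one_add_norm_pow_mul_exp {c : ℝ} (hc : 0 < c) (N : ℕ) :
    Integrable fun y : Fin n → ℂ => (1 + ‖y‖) ^ N * Real.exp (-(c * ‖y‖ ^ 2)) := by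
  set r : ℕ := Module.finrank ℝ (Fin n → ℂ) + 1 with hr
  have hint : Integrable fun y : Fin n → ℂ => (1 + ‖y‖) ^ (-(r : ℝ)) :=
    integrable_one_add_norm (by rw [hr]; push_cast; linarith)
  refine (hint.const_mul ((N + r).factorial * Real.exp (1 + 1 / (4 * c)))).mono'
    (by fun_prop) (.of_forall fun y => ?_)
  have ht : (0 : ℝ) < 1 + ‖y‖ := by positivity
  rw [Real.norm_of_nonneg (by positivity), Real.rpow_neg ht.le, Real.rpow_natCast,
    ← div_eq_mul_inv, le_div_iff₀ (by positivity)]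
  have h1 := Real.pow_div_factorial_le_exp (1 + ‖y‖) ht.le (N + r)
  rw [div_le_iff₀ (by positivity)] at h1
  have h2 : 1 + ‖y‖ + -(c * ‖y‖ ^ 2) ≤ 1 + 1 / (4 * c) := by
    have : 0 ≤ c * (‖y‖ - 1 / (2 * c)) ^ 2 := by positivity
    have e : c * (‖y‖ - 1 / (2 * c)) ^ 2 = c * ‖y‖ ^ 2 - ‖y‖ + 1 / (4 * c) := by
      field_simp; ring
    linarith
  calc (1 + ‖y‖) ^ N * Real.exp (-(c * ‖y‖ ^ 2)) * (1 + ‖y‖) ^ r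
      = (1 + ‖y‖) ^ (N + r) * Real.exp (-(c * ‖y‖ ^ 2)) := by ring
    _ ≤ Real.exp (1 + ‖y‖) * (N + r).factorial * Real.exp (-(c * ‖y‖ ^ 2)) := by gcongr
    _ = (N + r).factorial * Real.exp (1 + ‖y‖ + -(c * ‖y‖ ^ 2)) := by rw [Real.exp_add _ (-(c * ‖y‖ ^ 2))]; ring
    _ ≤ _ := by gcongr

/-- Continuous functions of at most polynomial growth. -/
def PolyGrowth (m : (Fin n → ℂ) → ℂ) : Prop :=
  Continuous m ∧ ∃ (C : ℝ) (N : ℕ), ∀ y, ‖m y‖ ≤ C * (1 + ‖y‖) ^ N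

theorem PolyGrowth.const (a : ℂ) : PolyGrowth fun _ : Fin n → ℂ => a :=
  ⟨continuous_const, ‖a‖, 0, fun y => by simp⟩

theorem PolyGrowth.coord (i : Fin n) : PolyGrowth fun y : Fin n → ℂ => y i :=
  ⟨continuous_apply i, 1, 1, fun y => by
    have := norm_le_pi_norm y i
    simp only [one_mul, pow_one]; linarith⟩

theorem PolyGrowth.star_coord (i : Fin n) : PolyGrowth fun y : Fin n → ℂ => star (y i) :=
  ⟨(continuous_apply i).star, 1, 1, fun y => by
    have := norm_le_pi_norm y i
    simp only [one_mul, pow_one, norm_star]; linarith⟩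

theorem PolyGrowth.mul {m m' : (Fin n → ℂ) → ℂ} (h : PolyGrowth m) (h' : PolyGrowth m') :
    PolyGrowth fun y => m y * m' y := by
  obtain ⟨hc, C, N, hm⟩ := h
  obtain ⟨hc', C', N', hm'⟩ := h'
  refine ⟨hc.mul hc', C * C', N + N', fun y => ?_⟩
  calc ‖m y * m' y‖ = ‖m y‖ * ‖m' y‖ := norm_mul _ _
    _ ≤ (C * (1 + ‖y‖) ^ N) * (C' * (1 + ‖y‖) ^ N') :=
      mul_le_mul (hm y) (hm' y) (norm_nonneg _) ((norm_nonneg _).trans (hm y))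
    _ = _ := by ring

theorem PolyGrowth.integrable {m : (Fin n → ℂ) → ℂ} (h : PolyGrowth m) {c : ℝ} (hc : 0 < c) :
    Integrable fun y => ‖m y‖ * Real.exp (-(c * ‖y‖ ^ 2)) := by
  obtain ⟨hm, C, N, hle⟩ := h
  refine ((integrable_one_add_norm_pow_mul_exp hc N).const_mul C).mono'
    (by fun_prop) (.of_forall fun y => ?_)
  rw [Real.norm_of_nonneg (by positivity), ← mul_assoc]
  gcongr
  exact hle y

theorem norm_cexp_neg_le {w : ℂ} {r : ℝ} (h : r ≤ w.re) : ‖Complex.exp (-w)‖ ≤ Real.exp (-r) := by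
  rw [Complex.norm_exp]; simpa using h

theorem PolyGrowth.integrable_metricForm {Φ : (Fin n → ℂ) → ℝ} (hΦ : ContDiff ℝ ∞ Φ)
    (hpos : ∀ z, (metricMatrix Φ z).PosDef) {m : (Fin n → ℂ) → ℂ} (h : PolyGrowth m)
    (z : Fin n → ℂ) : Integrable fun y => m y * Complex.exp (-metricForm Φ z y) := by
  obtain ⟨c, hc, hle⟩ := exists_le_metricForm hΦ hpos (isCompact_singleton (x := z))
  have hP := continuous_metricForm_right Φ z
  have hm := h.1
  refine (h.integrable hc).mono' (by fun_prop) (.of_forall fun y => ?_)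
  rw [norm_mul]
  gcongr
  exact norm_cexp_neg_le (hle z (Set.mem_singleton z) y)

/-- The Gaussian integral of `m` for the form `(H(z) y, y)`. -/
def gaussInt (Φ : (Fin n → ℂ) → ℝ) (m : (Fin n → ℂ) → ℂ) (z : Fin n → ℂ) : ℂ :=
  ∫ y, m y * Complex.exp (-metricForm Φ z y)

theorem hasFDerivAt_gaussInt {Φ : (Fin n → ℂ) → ℝ} (hΦ : ContDiff ℝ ∞ Φ)
    (hpos : ∀ z, (metricMatrix Φ z).PosDef) {m : (Fin n → ℂ) → ℂ} (h : PolyGrowth m)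
    (z : Fin n → ℂ) :
    HasFDerivAt (gaussInt Φ m) (∑ i, ∑ j, gaussInt Φ (fun y => -1 * m y * y i * star (y j)) z •
      fderiv ℝ (fun z => metricMatrix Φ z i j) z) z := by
  have hmij : ∀ i j, PolyGrowth fun y => -1 * m y * y i * star (y j) := fun i j =>
    (((PolyGrowth.const (-1)).mul h).mul (.coord i)).mul (.star_coord j)
  obtain ⟨c, hc, hle⟩ := exists_le_metricForm hΦ hpos (isCompact_closedBall z 1)
  have hB : ∀ i j, ∃ B, ∀ w ∈ Metric.closedBall z 1,
      ‖fderiv ℝ (fun z => metricMatrix Φ z i j) w‖ ≤ B := fun i j =>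
    (isCompact_closedBall z 1).exists_bound_of_continuousOn
      ((contDiff_metricMatrix hΦ i j).continuous_fderiv (by simp)).continuousOn
  choose B hB using hB
  have hint : (∑ i, ∑ j, gaussInt Φ (fun y => -1 * m y * y i * star (y j)) z •
      fderiv ℝ (fun z => metricMatrix Φ z i j) z)
      = ∫ y, ∑ i, ∑ j, ((-1 * m y * y i * star (y j)) * Complex.exp (-metricForm Φ z y)) •
        fderiv ℝ (fun z => metricMatrix Φ z i j) z := by
    rw [integral_finsetSum]
    · refine Finset.sum_congr rfl fun i _ => ?_
      rw [integral_finsetSum]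
      · refine Finset.sum_congr rfl fun j _ => ?_
        rw [integral_smul_const, gaussInt]
      · exact fun j _ => ((hmij i j).integrable_metricForm hΦ hpos z).smul_const _
    · exact fun i _ => integrable_finsetSum _ fun j _ =>
        ((hmij i j).integrable_metricForm hΦ hpos z).smul_const _
  have hP := continuous_metricForm_right Φ
  have hm := h.1
  rw [hint]
  refine hasFDerivAt_integral_of_dominated_of_fderiv_le (𝕜 := ℝ)
    (F' := fun w y => ∑ i, ∑ j,
      ((-1 * m y * y i * star (y j)) * Complex.exp (-metricForm Φ w y)) •
        fderiv ℝ (fun z => metricMatrix Φ z i j) w)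
    (bound := fun y => ∑ i, ∑ j,
      (‖-1 * m y * y i * star (y j)‖ * Real.exp (-(c * ‖y‖ ^ 2))) * B i j)
    (Metric.closedBall_mem_nhds z one_pos) (.of_forall fun w => ?_)
    (h.integrable_metricForm hΦ hpos z) ?_ (.of_forall fun y w hw => ?_) ?_
    (.of_forall fun y w hw => ?_)
  · have := hP w
    exact Continuous.aestronglyMeasurable (by fun_prop)
  · have := hP z
    exact Continuous.aestronglyMeasurable (by fun_prop)
  · refine (norm_sum_le _ _).trans (Finset.sum_le_sum fun i _ => (norm_sum_le _ _).trans
      (Finset.sum_le_sum fun j _ => ?_))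
    rw [norm_smul, norm_mul]
    gcongr
    · exact norm_cexp_neg_le (hle w hw y)
    · exact hB i j w hw
  · exact integrable_finsetSum _ fun i _ => integrable_finsetSum _ fun j _ =>
      ((hmij i j).integrable hc).mul_const _
  · have hd : HasFDerivAt (fun w => metricForm Φ w y)
        (∑ i, ∑ j, (y i * star (y j)) • fderiv ℝ (fun z => metricMatrix Φ z i j) w) w := by
      unfold metricForm
      refine HasFDerivAt.fun_sum fun i _ => HasFDerivAt.fun_sum fun j _ => ?_
      have := (((contDiff_metricMatrix hΦ i j).differentiable (by simp)) w).hasFDerivAt.mul_const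
        (y i * star (y j))
      simpa only [mul_assoc] using this
    refine ((hd.neg.cexp).const_mul (m y)).congr_fderiv ?_
    ext v
    simp only [smul_apply, neg_apply, sum_apply, Pi.neg_apply, smul_eq_mul, Finset.mul_sum,
      ← Finset.sum_neg_distrib]
    refine Finset.sum_congr rfl fun i _ => Finset.sum_congr rfl fun j _ => ?_
    ring

theorem contDiff_gaussInt {Φ : (Fin n → ℂ) → ℝ} (hΦ : ContDiff ℝ ∞ Φ)
    (hpos : ∀ z, (metricMatrix Φ z).PosDef) {m : (Fin n → ℂ) → ℂ} (h : PolyGrowth m) :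
    ContDiff ℝ ∞ (gaussInt Φ m) := by
  rw [contDiff_infty]
  intro r
  induction r generalizing m with
  | zero =>
    exact contDiff_zero.mpr (continuous_iff_continuousAt.mpr fun z =>
      (hasFDerivAt_gaussInt hΦ hpos h z).continuousAt)
  | succ r ih =>
    push_cast
    refine contDiff_succ_iff_fderiv.mpr
      ⟨fun z => (hasFDerivAt_gaussInt hΦ hpos h z).differentiableAt, by simp, ?_⟩
    rw [funext fun z => (hasFDerivAt_gaussInt hΦ hpos h z).fderiv]
    refine ContDiff.sum fun i _ => ContDiff.sum fun j _ => ContDiff.smul (ih ?_) ?_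
    · exact (((PolyGrowth.const (-1)).mul h).mul (.coord i)).mul (.star_coord j)
    · exact (contDiff_metricMatrix hΦ i j).fderiv_right (by exact_mod_cast le_top)

/-- Functions of `(z, y)` that are finite sums of products of a smooth function of `z` and a
function of polynomial growth of `y`. -/
inductive SmoothPoly : ((Fin n → ℂ) → (Fin n → ℂ) → ℂ) → Prop
  | mono (c m : (Fin n → ℂ) → ℂ) (hc : ContDiff ℝ ∞ c) (hm : PolyGrowth m) :
      SmoothPoly fun z y => c z * m y
  | add (G G' : (Fin n → ℂ) → (Fin n → ℂ) → ℂ) (hG : SmoothPoly G) (hG' : SmoothPoly G') :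
      SmoothPoly fun z y => G z y + G' z y

namespace SmoothPoly

variable {G G' : (Fin n → ℂ) → (Fin n → ℂ) → ℂ}

theorem smooth {c : (Fin n → ℂ) → ℂ} (hc : ContDiff ℝ ∞ c) : SmoothPoly fun z _ => c z := by
  simpa using mono c (fun _ => 1) hc (PolyGrowth.const 1)

theorem poly {m : (Fin n → ℂ) → ℂ} (hm : PolyGrowth m) : SmoothPoly fun _ y => m y := by
  simpa using mono (fun _ => 1) m contDiff_const hm

theorem const (a : ℂ) : SmoothPoly fun _ _ : Fin n → ℂ => a := smooth contDiff_const

theorem mul (hG : SmoothPoly G) (hG' : SmoothPoly G') : SmoothPoly fun z y => G z y * G' z y := by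
  induction hG with
  | mono c m hc hm =>
    induction hG' with
    | mono c' m' hc' hm' =>
      have := mono _ _ (hc.mul hc') (hm.mul hm')
      simpa only [mul_mul_mul_comm] using this
    | add _ _ _ _ ih ih' => simpa only [mul_add] using add _ _ ih ih'
  | add _ _ _ _ ih ih' => simpa only [add_mul] using add _ _ ih ih'

theorem sum {ι : Type*} (s : Finset ι) {G : ι → (Fin n → ℂ) → (Fin n → ℂ) → ℂ}
    (h : ∀ i ∈ s, SmoothPoly (G i)) : SmoothPoly fun z y => ∑ i ∈ s, G i z y := by
  classical
  induction s using Finset.induction_on with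
  | empty => simpa using const 0
  | insert i s hi ih =>
    simp only [Finset.sum_insert hi]
    exact add _ _ (h i (Finset.mem_insert_self i s))
      (ih fun j hj => h j (Finset.mem_insert_of_mem hj))

theorem prod {ι : Type*} (s : Finset ι) {G : ι → (Fin n → ℂ) → (Fin n → ℂ) → ℂ}
    (h : ∀ i ∈ s, SmoothPoly (G i)) : SmoothPoly fun z y => ∏ i ∈ s, G i z y := by
  classical
  induction s using Finset.induction_on with
  | empty => simpa using const 1
  | insert i s hi ih =>
    simp only [Finset.prod_insert hi]
    exact (h i (Finset.mem_insert_self i s)).mul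
      (ih fun j hj => h j (Finset.mem_insert_of_mem hj))

theorem pow (hG : SmoothPoly G) (k : ℕ) : SmoothPoly fun z y => G z y ^ k := by
  simpa using prod (Finset.range k) fun _ _ => hG

theorem sub (hG : SmoothPoly G) (hG' : SmoothPoly G') : SmoothPoly fun z y => G z y - G' z y := by
  simpa [sub_eq_add_neg] using add _ _ hG ((const (-1)).mul hG')

theorem continuous (hG : SmoothPoly G) :
    Continuous fun p : (Fin n → ℂ) × (Fin n → ℂ) => G p.1 p.2 := by
  induction hG with
  | mono c m hc hm => exact (hc.continuous.comp continuous_fst).mul (hm.1.comp continuous_snd)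
  | add _ _ _ _ ih ih' => exact ih.add ih'

theorem integrable {Φ : (Fin n → ℂ) → ℝ} (hΦ : ContDiff ℝ ∞ Φ)
    (hpos : ∀ z, (metricMatrix Φ z).PosDef) (hG : SmoothPoly G) (z : Fin n → ℂ) :
    Integrable fun y => G z y * Complex.exp (-metricForm Φ z y) := by
  induction hG with
  | mono c m hc hm =>
    simp only [mul_assoc]
    exact (hm.integrable_metricForm hΦ hpos z).const_mul _
  | add _ _ _ _ ih ih' => simp only [add_mul]; exact ih.add ih'

theorem contDiff_integral {Φ : (Fin n → ℂ) → ℝ} (hΦ : ContDiff ℝ ∞ Φ)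
    (hpos : ∀ z, (metricMatrix Φ z).PosDef) (hG : SmoothPoly G) :
    ContDiff ℝ ∞ fun z => ∫ y, G z y * Complex.exp (-metricForm Φ z y) := by
  induction hG with
  | mono c m hc hm =>
    simp only [mul_assoc, integral_const_mul]
    exact hc.mul (contDiff_gaussInt hΦ hpos hm)
  | add G G' hG hG' ih ih' =>
    have : ∀ z, ∫ y, (G z y + G' z y) * Complex.exp (-metricForm Φ z y)
        = (∫ y, G z y * Complex.exp (-metricForm Φ z y))
          + ∫ y, G' z y * Complex.exp (-metricForm Φ z y) := fun z => by
      simp only [add_mul]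
      exact integral_add (hG.integrable hΦ hpos z) (hG'.integrable hΦ hpos z)
    simp only [this]
    exact ih.add ih'

theorem exists_bound (hG : SmoothPoly G) {K : Set (Fin n → ℂ)} (hK : IsCompact K) {c : ℝ}
    (hc : 0 < c) : ∃ b : (Fin n → ℂ) → ℝ,
      (Integrable fun y => b y * Real.exp (-(c * ‖y‖ ^ 2))) ∧ ∀ z ∈ K, ∀ y, ‖G z y‖ ≤ b y := by
  induction hG with
  | mono a m ha hm =>
    obtain ⟨B, hB⟩ := hK.exists_bound_of_continuousOn ha.continuous.continuousOn
    refine ⟨fun y => B * ‖m y‖, ?_, fun z hz y => ?_⟩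
    · simpa only [mul_assoc] using (hm.integrable hc).const_mul B
    · rw [norm_mul]
      exact mul_le_mul_of_nonneg_right (hB z hz) (norm_nonneg _)
  | add _ _ _ _ ih ih' =>
    obtain ⟨b, hb, hle⟩ := ih
    obtain ⟨b', hb', hle'⟩ := ih'
    refine ⟨fun y => b y + b' y, ?_, fun z hz y => ?_⟩
    · simp only [add_mul]; exact hb.add hb'
    · exact (norm_add_le _ _).trans (add_le_add (hle z hz y) (hle' z hz y))

theorem integrable_prod {Φ : (Fin n → ℂ) → ℝ} (hΦ : ContDiff ℝ ∞ Φ)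
    (hpos : ∀ z, (metricMatrix Φ z).PosDef) (hG : SmoothPoly G) {K : Set (Fin n → ℂ)}
    (hK : IsCompact K) (hGK : ∀ z ∉ K, ∀ y, G z y = 0) :
    Integrable (Function.uncurry fun z y => G z y * Complex.exp (-metricForm Φ z y))
      (volume.prod volume) := by
  obtain ⟨c, hc, hle⟩ := exists_le_metricForm hΦ hpos hK
  obtain ⟨b, hb, hbG⟩ := hG.exists_bound hK hc
  have hind : Integrable (K.indicator fun _ => (1 : ℝ)) (volume : Measure (Fin n → ℂ)) :=
    (integrable_indicator_iff hK.measurableSet).mpr (by simp [hK.measure_lt_top])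
  refine (hind.mul_prod hb).mono' ?_ (.of_forall fun p => ?_)
  · exact Continuous.aestronglyMeasurable
      (hG.continuous.mul (continuous_metricForm hΦ).neg.cexp)
  · simp only [Function.uncurry]
    by_cases hp : p.1 ∈ K
    · rw [Set.indicator_of_mem hp, one_mul, norm_mul]
      have h1 := hbG p.1 hp p.2
      exact mul_le_mul h1 (norm_cexp_neg_le (hle p.1 hp p.2)) (norm_nonneg _)
        ((norm_nonneg _).trans h1)
    · simp [Set.indicator_of_notMem hp, hGK p.1 hp]

end SmoothPoly

end GaussianIntegrals

section SmoothFunctions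

variable {n : ℕ}

/-- The algebra of smooth complex valued functions on `ℂⁿ`. -/
def smoothAlg (n : ℕ) : Subalgebra ℂ ((Fin n → ℂ) → ℂ) where
  carrier := {f | ContDiff ℝ ∞ f}
  mul_mem' {f g} (hf : ContDiff ℝ ∞ f) (hg : ContDiff ℝ ∞ g) := hf.mul hg
  add_mem' {f g} (hf : ContDiff ℝ ∞ f) (hg : ContDiff ℝ ∞ g) := hf.add hg
  algebraMap_mem' c := (contDiff_const : ContDiff ℝ ∞ fun _ : Fin n → ℂ => c)

theorem contDiff_coe (f : smoothAlg n) : ContDiff ℝ ∞ (f : (Fin n → ℂ) → ℂ) := f.2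

/-- Evaluation of smooth functions at a point. -/
def evalAt (z : Fin n → ℂ) : smoothAlg n →+* ℂ :=
  (Pi.evalRingHom _ z).comp (smoothAlg n).val.toRingHom

theorem evalAt_apply (z : Fin n → ℂ) (f : smoothAlg n) :
    evalAt z f = (f : (Fin n → ℂ) → ℂ) z := rfl

theorem evalAt_smul (z : Fin n → ℂ) (c : ℂ) (f : smoothAlg n) :
    evalAt z (c • f) = c * evalAt z f := rfl

theorem smoothAlg_ext {f g : smoothAlg n} (h : ∀ z, evalAt z f = evalAt z g) : f = g :=
  Subtype.ext (funext h)

theorem differentiable_coe (f : smoothAlg n) :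
    Differentiable ℝ (f : (Fin n → ℂ) → ℂ) :=
  (contDiff_coe f).differentiable (by simp)

/-- The directional derivative as a derivation of the algebra of smooth functions. -/
def dirDeriv (w : Fin n → ℂ) : Derivation ℂ (smoothAlg n) (smoothAlg n) :=
  Derivation.mk'
    { toFun := fun f => ⟨fun z => fderiv ℝ (f : (Fin n → ℂ) → ℂ) z w,
        contDiff_fderiv_apply (contDiff_coe f) w⟩
      map_add' := fun f g => by
        refine Subtype.ext (funext fun z => ?_)
        have := fderiv_add (differentiable_coe f z) (differentiable_coe g z)
        exact congrArg (fun T => T w) this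
      map_smul' := fun c f => by
        refine Subtype.ext (funext fun z => ?_)
        have := fderiv_const_smul (differentiable_coe f z) c
        exact congrArg (fun T => T w) this }
    (fun f g => by
      refine Subtype.ext (funext fun z => ?_)
      have := fderiv_mul (differentiable_coe f z) (differentiable_coe g z)
      exact congrArg (fun T => T w) this)

theorem evalAt_dirDeriv (z w : Fin n → ℂ) (f : smoothAlg n) :
    evalAt z (dirDeriv w f) = fderiv ℝ (f : (Fin n → ℂ) → ℂ) z w := rfl

theorem commute_dirDeriv (v w : Fin n → ℂ) :
    Commute (dirDeriv v : smoothAlg n →ₗ[ℂ] smoothAlg n)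
      (dirDeriv w : smoothAlg n →ₗ[ℂ] smoothAlg n) := by
  refine LinearMap.ext fun f => smoothAlg_ext fun z => ?_
  have hd : ∀ u, fderiv ℝ (fun x => fderiv ℝ (f : (Fin n → ℂ) → ℂ) x u) z
      = (fderiv ℝ (fderiv ℝ (f : (Fin n → ℂ) → ℂ)) z).flip u := by
    intro u
    have h2 : ContDiff ℝ ∞ (fderiv ℝ (f : (Fin n → ℂ) → ℂ)) :=
      (contDiff_coe f).fderiv_right (by simp)
    rw [fderiv_clm_apply (h2.differentiable (by simp) z) (differentiableAt_const u)]
    simp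
  have hs : IsSymmSndFDerivAt ℝ (f : (Fin n → ℂ) → ℂ) z :=
    (contDiff_coe f).contDiffAt.isSymmSndFDerivAt (by
      simpa using (WithTop.coe_le_coe.mpr le_top : ((2 : ℕ∞) : WithTop ℕ∞) ≤ ∞))
  change fderiv ℝ (fun x => fderiv ℝ (f : (Fin n → ℂ) → ℂ) x w) z v
    = fderiv ℝ (fun x => fderiv ℝ (f : (Fin n → ℂ) → ℂ) x v) z w
  rw [hd, hd]
  exact hs v w

/-- The derivations `∂ᵢ` (left summand) and `∂̄ⱼ` (right summand) of the algebra of smooth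
functions. -/
def coordDeriv : Fin n ⊕ Fin n → Derivation ℂ (smoothAlg n) (smoothAlg n)
  | .inl i => (2⁻¹ : ℂ) • (dirDeriv (Pi.single i 1)
      + (-Complex.I) • dirDeriv (Pi.single i Complex.I))
  | .inr i => (2⁻¹ : ℂ) • (dirDeriv (Pi.single i 1)
      + Complex.I • dirDeriv (Pi.single i Complex.I))

theorem coe_coordDeriv_inl (i : Fin n) (f : smoothAlg n) :
    (coordDeriv (.inl i) f : (Fin n → ℂ) → ℂ) = dz i f := by
  funext z
  change 2⁻¹ * (fderiv ℝ (f : (Fin n → ℂ) → ℂ) z _ + (-Complex.I) * fderiv ℝ _ z _) = dz i f z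
  rw [dz]; ring

theorem coe_coordDeriv_inr (i : Fin n) (f : smoothAlg n) :
    (coordDeriv (.inr i) f : (Fin n → ℂ) → ℂ) = dzbar i f := by
  funext z
  change 2⁻¹ * (fderiv ℝ (f : (Fin n → ℂ) → ℂ) z _ + Complex.I * fderiv ℝ _ z _) = dzbar i f z
  rw [dzbar]; ring

theorem commute_coordDeriv (s t : Fin n ⊕ Fin n) :
    Commute (coordDeriv s : smoothAlg n →ₗ[ℂ] smoothAlg n)
      (coordDeriv t : smoothAlg n →ₗ[ℂ] smoothAlg n) := by
  have key : ∀ (a b : ℂ) (u v u' v' : Fin n → ℂ),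
      Commute ((((2⁻¹ : ℂ) • (dirDeriv u + a • dirDeriv v) :
          Derivation ℂ (smoothAlg n) (smoothAlg n))) : smoothAlg n →ₗ[ℂ] smoothAlg n)
        ((((2⁻¹ : ℂ) • (dirDeriv u' + b • dirDeriv v') :
          Derivation ℂ (smoothAlg n) (smoothAlg n))) : smoothAlg n →ₗ[ℂ] smoothAlg n) := by
    intro a b u v u' v'
    simp only [Derivation.coe_smul_linearMap, Derivation.coe_add_linearMap]
    refine Commute.smul_left (Commute.smul_right (Commute.add_left ?_ ?_) _) _
    · exact (commute_dirDeriv _ _).add_right ((commute_dirDeriv _ _).smul_right _)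
    · exact ((commute_dirDeriv _ _).add_right
        ((commute_dirDeriv _ _).smul_right _)).smul_left _
  rcases s with s | s <;> rcases t with t | t <;> exact key _ _ _ _ _ _

/-- The derivation `∑ᵢ aᵢ ∂ᵢ + ∑ⱼ bⱼ ∂̄ⱼ`. -/
def wirtinger (a b : Fin n → ℂ) : Derivation ℂ (smoothAlg n) (smoothAlg n) :=
  ∑ s, Sum.elim a b s • coordDeriv s

theorem wirtinger_add (a b a' b' : Fin n → ℂ) :
    wirtinger a b + wirtinger a' b' = wirtinger (a + a') (b + b') := by
  simp only [wirtinger, ← Finset.sum_add_distrib, ← add_smul]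
  refine Finset.sum_congr rfl fun s _ => ?_
  rcases s with s | s <;> rfl

theorem wirtinger_zero : wirtinger (0 : Fin n → ℂ) 0 = 0 := by
  refine Finset.sum_eq_zero fun s _ => ?_
  rcases s with s | s <;> simp

theorem coe_wirtinger (a b : Fin n → ℂ) :
    (wirtinger a b : smoothAlg n →ₗ[ℂ] smoothAlg n)
      = ∑ s, Sum.elim a b s • (coordDeriv s : smoothAlg n →ₗ[ℂ] smoothAlg n) := by
  refine LinearMap.ext fun f => ?_
  have := congrFun (map_sum (Derivation.coeFnAddMonoidHom (R := ℂ) (A := smoothAlg n)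
    (M := smoothAlg n)) (fun s => Sum.elim a b s • coordDeriv s) Finset.univ) f
  simpa [wirtinger, Finset.sum_apply] using this

theorem wirtinger_apply (a b : Fin n → ℂ) (f : smoothAlg n) :
    wirtinger a b f = ∑ s, Sum.elim a b s • coordDeriv s f := by
  have := congrArg (fun T : smoothAlg n →ₗ[ℂ] smoothAlg n => T f) (coe_wirtinger a b)
  simpa using this

theorem commute_wirtinger (a b a' b' : Fin n → ℂ) :
    Commute (wirtinger a b : smoothAlg n →ₗ[ℂ] smoothAlg n)
      (wirtinger a' b' : smoothAlg n →ₗ[ℂ] smoothAlg n) := by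
  rw [coe_wirtinger, coe_wirtinger]
  exact Commute.sum_left _ _ _ fun s _ => Commute.sum_right _ _ _ fun t _ =>
    ((commute_coordDeriv s t).smul_left _).smul_right _

theorem evalAt_wirtinger_star (y z : Fin n → ℂ) (f : smoothAlg n) :
    evalAt z (wirtinger y (star y) f) = fderiv ℝ (f : (Fin n → ℂ) → ℂ) z y := by
  have hy : y = ∑ i, ((y i).re • (Pi.single i 1 : Fin n → ℂ)
      + (y i).im • (Pi.single i Complex.I : Fin n → ℂ)) := by
    funext j
    simp only [Finset.sum_apply, Pi.add_apply, Pi.smul_apply, Pi.single_apply, Complex.real_smul,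
      Finset.sum_add_distrib, mul_ite, mul_zero, Finset.sum_ite_eq, Finset.mem_univ, if_true]
    simp
  conv_rhs => rw [hy]
  rw [wirtinger_apply, map_sum, Fintype.sum_sum_type, ← Finset.sum_add_distrib, map_sum]
  refine Finset.sum_congr rfl fun i _ => ?_
  simp only [Sum.elim_inl, Sum.elim_inr, evalAt_smul, map_add, map_smul, Complex.real_smul,
    Pi.star_apply]
  rw [evalAt_apply, evalAt_apply, coe_coordDeriv_inl, coe_coordDeriv_inr, dz, dzbar,
    Complex.star_def]
  set A := fderiv ℝ (f : (Fin n → ℂ) → ℂ) z (Pi.single i 1)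
  set B := fderiv ℝ (f : (Fin n → ℂ) → ℂ) z (Pi.single i Complex.I)
  have h1 : y i = (y i).re + (y i).im * Complex.I := (Complex.re_add_im _).symm
  have h2 : (starRingEnd ℂ) (y i) = (y i).re - (y i).im * Complex.I := by
    conv_lhs => rw [h1]
    simp only [map_add, map_mul, Complex.conj_ofReal, Complex.conj_I]
    ring
  rw [h2]
  nth_rewrite 1 [h1]
  linear_combination (-(y i).im * B) * Complex.I_sq

theorem coe_foldr_iterate {ι : Type*} (D : ι → Derivation ℂ (smoothAlg n) (smoothAlg n))
    (d : ι → ((Fin n → ℂ) → ℂ) → ((Fin n → ℂ) → ℂ))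
    (h : ∀ i f, (D i f : (Fin n → ℂ) → ℂ) = d i f) (a : ι → ℂ) (I : ι → ℕ) (l : List ι)
    (f : smoothAlg n) :
    ∃ g : smoothAlg n, (g : (Fin n → ℂ) → ℂ) = l.foldr (fun i g => (d i)^[I i] g) f ∧
      (l.map fun i => (a i • (D i : smoothAlg n →ₗ[ℂ] smoothAlg n)) ^ I i).prod f
        = (l.map fun i => a i ^ I i).prod • g := by
  have hiter : ∀ i k (g : smoothAlg n),
      ((((D i : smoothAlg n →ₗ[ℂ] smoothAlg n) ^ k) g : smoothAlg n) : (Fin n → ℂ) → ℂ)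
        = (d i)^[k] g := by
    intro i k g
    induction k with
    | zero => rfl
    | succ k ih =>
      rw [pow_succ', Function.iterate_succ_apply', ← ih]
      exact h i _
  induction l with
  | nil => exact ⟨f, rfl, by simp⟩
  | cons i l ih =>
    obtain ⟨g, hg, he⟩ := ih
    refine ⟨((D i : smoothAlg n →ₗ[ℂ] smoothAlg n) ^ I i) g, ?_, ?_⟩
    · rw [hiter, hg]; rfl
    · rw [List.map_cons, List.prod_cons, Module.End.mul_apply, he, map_smul, smul_pow,
        LinearMap.smul_apply, smul_smul, List.map_cons, List.prod_cons, mul_comm]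

theorem evalAt_noncommProd (a b : Fin n → ℂ) (K : Fin n ⊕ Fin n → ℕ)
    (hc : ((Finset.univ : Finset (Fin n ⊕ Fin n)) : Set (Fin n ⊕ Fin n)).Pairwise
      (Function.onFun Commute fun s =>
        (Sum.elim a b s • (coordDeriv s : smoothAlg n →ₗ[ℂ] smoothAlg n)) ^ K s))
    (f : smoothAlg n) (z : Fin n → ℂ) :
    evalAt z (Finset.univ.noncommProd (fun s =>
        (Sum.elim a b s • (coordDeriv s : smoothAlg n →ₗ[ℂ] smoothAlg n)) ^ K s) hc f)
      = ((∏ i, a i ^ K (Sum.inl i)) * ∏ j, b j ^ K (Sum.inr j))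
        * dzMulti (fun i => K (Sum.inl i)) (dzbarMulti (fun j => K (Sum.inr j)) f) z := by
  set l : List (Fin n ⊕ Fin n) :=
    (List.finRange n).map Sum.inl ++ (List.finRange n).map Sum.inr with hl
  have hnd : l.Nodup := by
    rw [hl, List.nodup_append]
    refine ⟨(List.nodup_finRange n).map Sum.inl_injective,
      (List.nodup_finRange n).map Sum.inr_injective, ?_⟩
    simp
  have hlu : (Finset.univ : Finset (Fin n ⊕ Fin n)) = l.toFinset := by
    ext s
    rcases s with s | s <;> simp [hl]
  have hprod : ∀ (c : Fin n → ℂ) (L : Fin n → ℕ),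
      ((List.finRange n).map fun i => c i ^ L i).prod = ∏ i, c i ^ L i := by
    intro c L
    rw [← List.ofFn_eq_map, List.prod_ofFn]
  obtain ⟨g, hg, hgf⟩ := coe_foldr_iterate (fun j : Fin n => coordDeriv (.inr j)) dzbar
    coe_coordDeriv_inr b (fun j => K (Sum.inr j)) (List.finRange n) f
  obtain ⟨g', hg', hgf'⟩ := coe_foldr_iterate (fun i : Fin n => coordDeriv (.inl i)) dz
    coe_coordDeriv_inl a (fun i => K (Sum.inl i)) (List.finRange n) g
  have hgen : ∀ (S : Finset (Fin n ⊕ Fin n)) (hS : S = l.toFinset)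
      (hc : (S : Set (Fin n ⊕ Fin n)).Pairwise (Function.onFun Commute fun s =>
        (Sum.elim a b s • (coordDeriv s : smoothAlg n →ₗ[ℂ] smoothAlg n)) ^ K s)),
      S.noncommProd _ hc = (l.map fun s =>
        (Sum.elim a b s • (coordDeriv s : smoothAlg n →ₗ[ℂ] smoothAlg n)) ^ K s).prod := by
    rintro S rfl hc
    exact Finset.noncommProd_toFinset _ _ hc hnd
  have hmul : (l.map fun s =>
      (Sum.elim a b s • (coordDeriv s : smoothAlg n →ₗ[ℂ] smoothAlg n)) ^ K s).prod f
        = (∏ j, b j ^ K (Sum.inr j)) • (∏ i, a i ^ K (Sum.inl i)) • g' := by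
    rw [hl, List.map_append, List.prod_append, List.map_map, List.map_map, Module.End.mul_apply,
      ← hprod, ← hprod, ← hgf', ← map_smul, ← hgf]
    rfl
  rw [hgen _ hlu hc, hmul, evalAt_smul, evalAt_smul, evalAt_apply, hg', hg, ← mul_assoc,
    mul_comm (∏ j, b j ^ K (Sum.inr j))]
  rfl

theorem contDiff_dzMulti (I J : Fin n → ℕ) {f : (Fin n → ℂ) → ℂ} (hf : ContDiff ℝ ∞ f) :
    ContDiff ℝ ∞ (dzMulti I (dzbarMulti J f)) := by
  obtain ⟨g, hg, -⟩ := coe_foldr_iterate (fun j : Fin n => coordDeriv (.inr j)) dzbar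
    coe_coordDeriv_inr 0 J (List.finRange n) ⟨f, hf⟩
  obtain ⟨g', hg', -⟩ := coe_foldr_iterate (fun i : Fin n => coordDeriv (.inl i)) dz
    coe_coordDeriv_inl 0 I (List.finRange n) g
  rw [hg] at hg'
  have := contDiff_coe g'
  rwa [hg'] at this

theorem formalTaylor_eq_flow (f : smoothAlg n) (z a b : Fin n → ℂ) :
    formalTaylor f z a b
      = PowerSeries.map (evalAt z) (flow (wirtinger a b) (PowerSeries.C f)) := by
  have hc : ((Finset.univ : Finset (Fin n ⊕ Fin n)) : Set (Fin n ⊕ Fin n)).Pairwise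
      (Function.onFun Commute fun s =>
        Sum.elim a b s • (coordDeriv s : smoothAlg n →ₗ[ℂ] smoothAlg n)) := fun s _ t _ _ =>
    ((commute_coordDeriv s t).smul_left _).smul_right _
  ext k
  rw [PowerSeries.coeff_map, coeff_flow_C, coe_wirtinger,
    Finset.sum_pow_eq_sum_piAntidiag_of_commute _ _ hc, formalTaylor, PowerSeries.coeff_mk,
    LinearMap.sum_apply, evalAt_smul, map_sum, Finset.mul_sum]
  refine Finset.sum_congr rfl fun K hK => ?_
  have hk : ((∏ i, ((K (Sum.inl i)).factorial : ℂ)) * ∏ j, ((K (Sum.inr j)).factorial : ℂ))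
      * (Nat.multinomial Finset.univ K : ℂ) = k.factorial := by
    rw [← (Finset.mem_piAntidiag.mp hK).1, ← Nat.multinomial_spec, Fintype.prod_sum_type]
    push_cast
    rfl
  have h0 : (k.factorial : ℂ) ≠ 0 := by exact_mod_cast k.factorial_ne_zero
  have h1 := left_ne_zero_of_mul (hk ▸ h0)
  rw [Module.End.mul_apply, Module.End.natCast_apply, map_nsmul, nsmul_eq_mul,
    evalAt_noncommProd, ← hk]
  rw [← hk] at h0
  have h2 := right_ne_zero_of_mul h0
  field_simp

end SmoothFunctions

section CyclicInvariance

variable {n : ℕ}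

/-- The ideal of smooth functions vanishing outside `K`. -/
def supportedIdeal (K : Set (Fin n → ℂ)) : Ideal (smoothAlg n) where
  carrier := {f | ∀ z ∉ K, evalAt z f = 0}
  add_mem' hf hg z hz := by rw [map_add, hf z hz, hg z hz, add_zero]
  zero_mem' z _ := map_zero _
  smul_mem' c f hf z hz := by rw [smul_eq_mul, map_mul, hf z hz, mul_zero]

theorem smul_mem_supportedIdeal {K : Set (Fin n → ℂ)} {f : smoothAlg n} (c : ℂ)
    (hf : f ∈ supportedIdeal K) : c • f ∈ supportedIdeal K := fun z hz => by
  rw [evalAt_smul, hf z hz, mul_zero]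

theorem dirDeriv_mem_supportedIdeal {K : Set (Fin n → ℂ)} (hK : IsClosed K) {f : smoothAlg n}
    (hf : f ∈ supportedIdeal K) (w : Fin n → ℂ) : dirDeriv w f ∈ supportedIdeal K := by
  intro z hz
  have : (f : (Fin n → ℂ) → ℂ) =ᶠ[nhds z] fun _ => 0 :=
    Filter.eventually_of_mem (hK.isOpen_compl.mem_nhds hz) hf
  rw [evalAt_dirDeriv, this.fderiv_eq]
  simp

theorem coordDeriv_mem_supportedIdeal {K : Set (Fin n → ℂ)} (hK : IsClosed K) {f : smoothAlg n}
    (hf : f ∈ supportedIdeal K) (s : Fin n ⊕ Fin n) : coordDeriv s f ∈ supportedIdeal K := by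
  rcases s with s | s <;>
  exact smul_mem_supportedIdeal _ (add_mem (dirDeriv_mem_supportedIdeal hK hf _)
    (smul_mem_supportedIdeal _ (dirDeriv_mem_supportedIdeal hK hf _)))

theorem wirtinger_pow_mem_supportedIdeal {K : Set (Fin n → ℂ)} (hK : IsClosed K)
    {f : smoothAlg n} (hf : f ∈ supportedIdeal K) (a b : Fin n → ℂ) (k : ℕ) :
    ((wirtinger a b : smoothAlg n →ₗ[ℂ] smoothAlg n) ^ k) f ∈ supportedIdeal K := by
  induction k with
  | zero => exact hf
  | succ k ih =>
    rw [pow_succ', Module.End.mul_apply, Derivation.coeFn_coe, wirtinger_apply]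
    exact sum_mem fun s _ =>
      smul_mem_supportedIdeal _ (coordDeriv_mem_supportedIdeal hK ih s)

theorem coeff_flow_C_mem_supportedIdeal {K : Set (Fin n → ℂ)} (hK : IsClosed K)
    {f : smoothAlg n} (hf : f ∈ supportedIdeal K) (a b : Fin n → ℂ) (k : ℕ) :
    PowerSeries.coeff k (flow (wirtinger a b) (PowerSeries.C f)) ∈ supportedIdeal K := by
  rw [coeff_flow_C]
  exact smul_mem_supportedIdeal _ (wirtinger_pow_mem_supportedIdeal hK hf a b k)

theorem coeff_mul_mem {R : Type*} [CommRing R] {I : Ideal R} {A : PowerSeries R}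
    (hA : ∀ k, PowerSeries.coeff k A ∈ I) (B : PowerSeries R) (k : ℕ) :
    PowerSeries.coeff k (A * B) ∈ I := by
  rw [PowerSeries.coeff_mul]
  exact sum_mem fun p _ => I.mul_mem_right _ (hA _)

theorem hasCompactSupport_of_mem {K : Set (Fin n → ℂ)} (hK : IsCompact K) {f : smoothAlg n}
    (hf : f ∈ supportedIdeal K) : HasCompactSupport (f : (Fin n → ℂ) → ℂ) :=
  HasCompactSupport.intro hK hf

theorem integrable_of_mem {K : Set (Fin n → ℂ)} (hK : IsCompact K) {f : smoothAlg n}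
    (hf : f ∈ supportedIdeal K) : Integrable fun z => evalAt z f :=
  (contDiff_coe f).continuous.integrable_of_hasCompactSupport (hasCompactSupport_of_mem hK hf)

theorem integral_wirtinger_star {K : Set (Fin n → ℂ)} (hK : IsCompact K) {f : smoothAlg n}
    (hf : f ∈ supportedIdeal K) (y : Fin n → ℂ) :
    ∫ z, evalAt z (wirtinger y (star y) f) = 0 := by
  have hX : wirtinger y (star y) f ∈ supportedIdeal K := by
    simpa using wirtinger_pow_mem_supportedIdeal hK.isClosed hf y (star y) 1
  have hi := integrable_of_mem hK hX
  have hi' := integrable_of_mem hK hf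
  simp only [evalAt_wirtinger_star] at hi ⊢
  have := integral_mul_fderiv_eq_neg_fderiv_mul_of_integrable (μ := volume) (𝕜 := ℂ)
    (f := fun _ : Fin n → ℂ => (1 : ℂ)) (g := (f : (Fin n → ℂ) → ℂ)) (v := y) (by simp)
    (by simpa using hi) (by simpa [evalAt_apply] using hi') (fun x _ => differentiableAt_const _)
    (fun x _ => differentiable_coe f x)
  simpa using this

theorem integral_coeff_flow {K : Set (Fin n → ℂ)} (hK : IsCompact K)
    {A : PowerSeries (smoothAlg n)} (hA : ∀ k, PowerSeries.coeff k A ∈ supportedIdeal K)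
    (y : Fin n → ℂ) (k : ℕ) :
    ∫ z, evalAt z (PowerSeries.coeff k (flow (wirtinger y (star y)) A))
      = ∫ z, evalAt z (PowerSeries.coeff k A) := by
  have hmem := fun p : ℕ × ℕ =>
    wirtinger_pow_mem_supportedIdeal hK.isClosed (hA p.2) y (star y) p.1
  simp only [coeff_flow, map_sum, evalAt_smul]
  rw [integral_finsetSum _ fun p _ => (integrable_of_mem hK (hmem p)).const_mul _,
    Finset.sum_eq_single (0, k)]
  · simp
  · rintro ⟨i, j⟩ hij hne
    obtain ⟨i, rfl⟩ : ∃ i', i = i' + 1 := by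
      refine Nat.exists_eq_succ_of_ne_zero ?_
      rintro rfl
      apply hne
      simpa using hij
    rw [integral_const_mul]
    simp only [pow_succ', Module.End.mul_apply, Derivation.coeFn_coe]
    rw [integral_wirtinger_star hK (wirtinger_pow_mem_supportedIdeal hK.isClosed (hA j) _ _ _),
      mul_zero]
  · simp

theorem wirtinger_add_star (y : Fin n → ℂ) :
    wirtinger y 0 + wirtinger 0 (star y) = wirtinger y (star y) := by
  rw [wirtinger_add]; simp

theorem formalExp_map (z : Fin n → ℂ) (V : PowerSeries (smoothAlg n)) :
    formalExp (PowerSeries.map (evalAt z) V) = PowerSeries.map (evalAt z) (seriesExp V) := by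
  ext k
  simp only [formalExp, seriesExp, PowerSeries.coeff_mk, PowerSeries.coeff_map, map_sum,
    ← map_pow, evalAt_smul]
  exact Finset.sum_congr rfl fun m _ => by rw [div_eq_inv_mul]

theorem formalIntegrand_eq_map (Φ : (Fin n → ℂ) → ℝ) (φ d g₁ g₂ : smoothAlg n)
    (hφ : (φ : (Fin n → ℂ) → ℂ) = fun v => (Φ v : ℂ)) (hd : (d : (Fin n → ℂ) → ℂ) = metricDet Φ)
    (z y : Fin n → ℂ) :
    formalIntegrand Φ g₁ g₂ z y
      = PowerSeries.map (evalAt z)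
          (integrandSeries (wirtinger y 0) (wirtinger 0 (star y)) φ d g₁ g₂) := by
  have hsum := wirtinger_add_star y
  have hc : formalCalabi Φ z y
      = PowerSeries.map (evalAt z) (calabiSeries (wirtinger y 0) (wirtinger 0 (star y)) φ) := by
    simp only [formalCalabi, calabiSeries, map_add, map_sub, ← hφ, formalTaylor_eq_flow,
      wirtinger_zero, flow_zero_C, hsum]
  have ht : calabiTail Φ z y
      = PowerSeries.map (evalAt z) (calabiTailSeries (wirtinger y 0) (wirtinger 0 (star y)) φ) := by
    ext k
    simp only [calabiTail, calabiTailSeries, PowerSeries.coeff_mk, PowerSeries.coeff_map, hc]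
    split_ifs <;> simp
  simp only [formalIntegrand, integrandSeries, map_mul, ← hd, formalTaylor_eq_flow, ht,
    formalExp_map, hsum]

/-- The Hermitian form `(H y, y)` as a smooth function of the base point. -/
def formFn (φ : smoothAlg n) (y : Fin n → ℂ) : smoothAlg n :=
  wirtinger y 0 (wirtinger 0 (star y) φ)

theorem evalAt_formFn (Φ : (Fin n → ℂ) → ℝ) (φ : smoothAlg n)
    (hφ : (φ : (Fin n → ℂ) → ℂ) = fun v => (Φ v : ℂ)) (z y : Fin n → ℂ) :
    evalAt z (formFn φ y) = metricForm Φ z y := by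
  have hij : ∀ i j, evalAt z (coordDeriv (.inl i) (coordDeriv (.inr j) φ))
      = metricMatrix Φ z i j := by
    intro i j
    rw [evalAt_apply, coe_coordDeriv_inl, coe_coordDeriv_inr, hφ]
    rfl
  simp only [formFn, wirtinger_apply, Fintype.sum_sum_type, Sum.elim_inl, Sum.elim_inr,
    Pi.zero_apply, zero_smul, Finset.sum_const_zero, add_zero, zero_add, map_sum,
    evalAt_smul, hij, metricForm, Finset.mul_sum, Derivation.map_smul, Pi.star_apply]
  rw [Finset.sum_comm]
  refine Finset.sum_congr rfl fun i _ => Finset.sum_congr rfl fun j _ => ?_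
  ring

theorem wirtinger_neg (a b : Fin n → ℂ) : wirtinger (-a) (-b) = -wirtinger a b := by
  refine Derivation.ext fun f => ?_
  rw [Derivation.neg_apply, wirtinger_apply, wirtinger_apply, ← Finset.sum_neg_distrib]
  refine Finset.sum_congr rfl fun s _ => ?_
  rcases s with s | s <;> simp

theorem wirtinger_neg_left (y : Fin n → ℂ) : wirtinger (-y) 0 = -wirtinger y 0 := by
  simpa using wirtinger_neg y 0

theorem wirtinger_neg_right (y : Fin n → ℂ) : wirtinger 0 (-y) = -wirtinger 0 y := by
  simpa using wirtinger_neg 0 y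

theorem formFn_neg (φ : smoothAlg n) (y : Fin n → ℂ) : formFn φ (-y) = formFn φ y := by
  rw [formFn, formFn, star_neg, wirtinger_neg_left, wirtinger_neg_right, Derivation.neg_apply,
    Derivation.neg_apply, map_neg, neg_neg]

/-- The smooth function `exp (- (H y, y))`. -/
def expForm (φ : smoothAlg n) (y : Fin n → ℂ) : smoothAlg n :=
  ⟨fun z => Complex.exp (evalAt z (-formFn φ y)), (contDiff_coe (-formFn φ y)).cexp⟩

theorem wirtinger_expForm (φ : smoothAlg n) (y : Fin n → ℂ) :
    wirtinger y (star y) (expForm φ y) = wirtinger y (star y) (-formFn φ y) * expForm φ y := by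
  refine smoothAlg_ext fun z => ?_
  rw [map_mul, evalAt_wirtinger_star, evalAt_wirtinger_star]
  have h := (differentiable_coe (-formFn φ y) z).hasFDerivAt.cexp
  change fderiv ℝ (fun z => Complex.exp (((-formFn φ y : smoothAlg n) : (Fin n → ℂ) → ℂ) z)) z y = _
  rw [h.fderiv]
  simp only [smul_apply, smul_eq_mul]
  rw [mul_comm]
  rfl

theorem coeff_integrandSeries_mem {K : Set (Fin n → ℂ)} (hK : IsClosed K) (φ d : smoothAlg n)
    {g₁ g₂ : smoothAlg n} (hg : g₁ ∈ supportedIdeal K) (y : Fin n → ℂ) (k : ℕ) :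
    PowerSeries.coeff k (integrandSeries (wirtinger y 0) (wirtinger 0 (star y)) φ d g₁ g₂)
      ∈ supportedIdeal K := by
  refine coeff_mul_mem (fun k => coeff_mul_mem (fun k => coeff_mul_mem (fun k => ?_) _ k) _ k) _ k
  exact coeff_flow_C_mem_supportedIdeal hK hg _ _ _

theorem integral_integrandSeries_swap {K : Set (Fin n → ℂ)} (hK : IsCompact K)
    (φ d g₁ : smoothAlg n) {g₂ : smoothAlg n} (hg : g₂ ∈ supportedIdeal K) (y : Fin n → ℂ)
    (k : ℕ) :
    ∫ z, evalAt z (PowerSeries.coeff k (integrandSeries (wirtinger y 0) (wirtinger 0 (star y))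
        φ d g₁ g₂ * PowerSeries.C (expForm φ y) * PowerSeries.C d))
      = ∫ z, evalAt z (PowerSeries.coeff k (integrandSeries (wirtinger (-y) 0)
        (wirtinger 0 (star (-y))) φ d g₂ g₁ * PowerSeries.C (expForm φ (-y))
          * PowerSeries.C d)) := by
  have he : expForm φ (-y) = expForm φ y := by simp only [expForm, formFn_neg]
  have hE := wirtinger_expForm φ y
  rw [← wirtinger_add_star, formFn] at hE
  have hflow := flow_integrandSeries_neg (commute_wirtinger y 0 0 (star y)) hE d g₁ g₂
  rw [wirtinger_add_star, ← wirtinger_neg_left, ← wirtinger_neg_right, ← star_neg] at hflow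
  rw [he, ← hflow]
  refine integral_coeff_flow hK (fun k => ?_) y k
  exact coeff_mul_mem (coeff_mul_mem (coeff_integrandSeries_mem hK.isClosed φ d hg (-y)) _) _ k

theorem smoothPoly_coeff_formalTaylor {f : (Fin n → ℂ) → ℂ} (hf : ContDiff ℝ ∞ f)
    {a b : (Fin n → ℂ) → Fin n → ℂ} (ha : ∀ i, PolyGrowth fun y => a y i)
    (hb : ∀ i, PolyGrowth fun y => b y i) (k : ℕ) :
    SmoothPoly fun z y => PowerSeries.coeff k (formalTaylor f z (a y) (b y)) := by
  simp only [formalTaylor, PowerSeries.coeff_mk]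
  refine SmoothPoly.sum _ fun K _ => SmoothPoly.mul ?_ (SmoothPoly.mul ?_ ?_)
  · exact SmoothPoly.smooth ((contDiff_dzMulti _ _ hf).div_const _)
  · exact SmoothPoly.prod _ fun i _ => (SmoothPoly.poly (ha i)).pow _
  · exact SmoothPoly.prod _ fun i _ => (SmoothPoly.poly (hb i)).pow _

theorem smoothPoly_coeff_mul {A B : (Fin n → ℂ) → (Fin n → ℂ) → PowerSeries ℂ}
    (hA : ∀ k, SmoothPoly fun z y => PowerSeries.coeff k (A z y))
    (hB : ∀ k, SmoothPoly fun z y => PowerSeries.coeff k (B z y)) (k : ℕ) :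
    SmoothPoly fun z y => PowerSeries.coeff k (A z y * B z y) := by
  simp only [PowerSeries.coeff_mul]
  exact SmoothPoly.sum _ fun p _ => (hA _).mul (hB _)

theorem smoothPoly_coeff_pow {A : (Fin n → ℂ) → (Fin n → ℂ) → PowerSeries ℂ}
    (hA : ∀ k, SmoothPoly fun z y => PowerSeries.coeff k (A z y)) (m k : ℕ) :
    SmoothPoly fun z y => PowerSeries.coeff k (A z y ^ m) := by
  induction m generalizing k with
  | zero => simpa using SmoothPoly.const _
  | succ m ih => simpa only [pow_succ] using smoothPoly_coeff_mul ih hA k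

theorem smoothPoly_coeff_formalExp {A : (Fin n → ℂ) → (Fin n → ℂ) → PowerSeries ℂ}
    (hA : ∀ k, SmoothPoly fun z y => PowerSeries.coeff k (A z y)) (k : ℕ) :
    SmoothPoly fun z y => PowerSeries.coeff k (formalExp (A z y)) := by
  simp only [formalExp, PowerSeries.coeff_mk, div_eq_mul_inv]
  exact SmoothPoly.sum _ fun m _ => (smoothPoly_coeff_pow hA m k).mul (SmoothPoly.const _)

theorem smoothPoly_coeff_formalIntegrand {Φ : (Fin n → ℂ) → ℝ} (hΦ : ContDiff ℝ ∞ Φ)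
    {f₁ f₂ : (Fin n → ℂ) → ℂ} (hf₁ : ContDiff ℝ ∞ f₁) (hf₂ : ContDiff ℝ ∞ f₂) (k : ℕ) :
    SmoothPoly fun z y => PowerSeries.coeff k (formalIntegrand Φ f₁ f₂ z y) := by
  have h0 : ∀ i : Fin n, PolyGrowth fun _ : Fin n → ℂ => (0 : Fin n → ℂ) i := fun i => .const 0
  have h1 : ∀ i : Fin n, PolyGrowth fun y : Fin n → ℂ => y i := .coord
  have h2 : ∀ i : Fin n, PolyGrowth fun y : Fin n → ℂ => (star y) i := .star_coord
  have hφ := contDiff_ofReal_comp hΦ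
  unfold formalIntegrand
  refine smoothPoly_coeff_mul (smoothPoly_coeff_mul (smoothPoly_coeff_mul
    (smoothPoly_coeff_formalTaylor hf₁ h0 h2) (smoothPoly_coeff_formalTaylor hf₂ h1 h0))
    (smoothPoly_coeff_formalExp fun k => ?_))
    (smoothPoly_coeff_formalTaylor (contDiff_metricDet hΦ) h1 h2) k
  simp only [calabiTail, PowerSeries.coeff_mk]
  split_ifs
  · exact SmoothPoly.const 0
  · simp only [formalCalabi, map_add, map_sub]
    exact (((smoothPoly_coeff_formalTaylor hφ h0 h2 _).add _ _
      (smoothPoly_coeff_formalTaylor hφ h1 h0 _)).sub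
      (smoothPoly_coeff_formalTaylor hφ h0 h0 _)).sub (smoothPoly_coeff_formalTaylor hφ h1 h2 _)

theorem mem_supportedIdeal_tsupport (g : smoothAlg n) :
    g ∈ supportedIdeal (tsupport (g : (Fin n → ℂ) → ℂ)) := fun _ hz =>
  image_eq_zero_of_notMem_tsupport (f := (g : (Fin n → ℂ) → ℂ)) hz

theorem coeff_formalIntegrand_eq_zero {Φ : (Fin n → ℂ) → ℝ} (hΦ : ContDiff ℝ ∞ Φ)
    {f₁ f₂ : (Fin n → ℂ) → ℂ} (hf₁ : ContDiff ℝ ∞ f₁) (hf₂ : ContDiff ℝ ∞ f₂) (k : ℕ)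
    {z : Fin n → ℂ} (hz : z ∉ tsupport f₁) (y : Fin n → ℂ) :
    PowerSeries.coeff k (formalIntegrand Φ f₁ f₂ z y) = 0 := by
  have h := formalIntegrand_eq_map Φ ⟨_, contDiff_ofReal_comp hΦ⟩ ⟨_, contDiff_metricDet hΦ⟩
    ⟨f₁, hf₁⟩ ⟨f₂, hf₂⟩ rfl rfl z y
  change formalIntegrand Φ f₁ f₂ z y = _ at h
  rw [h, PowerSeries.coeff_map]
  exact coeff_integrandSeries_mem (isClosed_tsupport f₁) _ _
    (mem_supportedIdeal_tsupport ⟨f₁, hf₁⟩) y k z hz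

theorem contDiff_laplaceCoeff {Φ : (Fin n → ℂ) → ℝ} (hΦ : ContDiff ℝ ∞ Φ)
    (hpos : ∀ z, (metricMatrix Φ z).PosDef) {f₁ f₂ : (Fin n → ℂ) → ℂ} (hf₁ : ContDiff ℝ ∞ f₁)
    (hf₂ : ContDiff ℝ ∞ f₂) (k : ℕ) : ContDiff ℝ ∞ (laplaceCoeff Φ k f₁ f₂) :=
  contDiff_const.mul ((smoothPoly_coeff_formalIntegrand hΦ hf₁ hf₂ k).contDiff_integral hΦ hpos)

theorem hasCompactSupport_laplaceCoeff {Φ : (Fin n → ℂ) → ℝ} (hΦ : ContDiff ℝ ∞ Φ)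
    {f₁ f₂ : (Fin n → ℂ) → ℂ} (hf₁ : ContDiff ℝ ∞ f₁) (hf₂ : ContDiff ℝ ∞ f₂)
    (hs : HasCompactSupport f₁) (k : ℕ) : HasCompactSupport (laplaceCoeff Φ k f₁ f₂) :=
  HasCompactSupport.intro hs fun z hz => by
    simp [laplaceCoeff, coeff_formalIntegrand_eq_zero hΦ hf₁ hf₂ k hz]

theorem integral_laplaceCoeff_mul_metricDet {Φ : (Fin n → ℂ) → ℝ} (hΦ : ContDiff ℝ ∞ Φ)
    (hpos : ∀ z, (metricMatrix Φ z).PosDef) {f₁ f₂ : (Fin n → ℂ) → ℂ} (hf₁ : ContDiff ℝ ∞ f₁)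
    (hf₂ : ContDiff ℝ ∞ f₂) (hs : HasCompactSupport f₁) (k : ℕ) :
    ∫ z, laplaceCoeff Φ k f₁ f₂ z * metricDet Φ z
      = ((Real.pi : ℂ) ^ n)⁻¹ * ∫ y, ∫ z, PowerSeries.coeff k (formalIntegrand Φ f₁ f₂ z y)
        * metricDet Φ z * Complex.exp (-metricForm Φ z y) := by
  have hG := (smoothPoly_coeff_formalIntegrand hΦ hf₁ hf₂ k).mul
    (SmoothPoly.smooth (contDiff_metricDet hΦ))
  have hint := hG.integrable_prod hΦ hpos hs fun z hz y => by
    rw [coeff_formalIntegrand_eq_zero hΦ hf₁ hf₂ k hz, zero_mul]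
  rw [← integral_integral_swap hint, ← integral_const_mul]
  refine integral_congr_ae (.of_forall fun z => ?_)
  change _ * (∫ y, _) * _ = _
  rw [mul_assoc, ← integral_mul_const]
  refine congrArg _ (integral_congr_ae (.of_forall fun y => ?_))
  exact mul_right_comm _ _ _

theorem integral_laplaceCoeff_comm {Φ : (Fin n → ℂ) → ℝ} (hΦ : ContDiff ℝ ∞ Φ)
    (hpos : ∀ z, (metricMatrix Φ z).PosDef) {f₁ f₂ : (Fin n → ℂ) → ℂ} (hf₁ : ContDiff ℝ ∞ f₁)
    (hf₂ : ContDiff ℝ ∞ f₂) (hs₁ : HasCompactSupport f₁) (hs₂ : HasCompactSupport f₂) (k : ℕ) :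
    ∫ z, laplaceCoeff Φ k f₁ f₂ z * metricDet Φ z
      = ∫ z, laplaceCoeff Φ k f₂ f₁ z * metricDet Φ z := by
  rw [integral_laplaceCoeff_mul_metricDet hΦ hpos hf₁ hf₂ hs₁,
    integral_laplaceCoeff_mul_metricDet hΦ hpos hf₂ hf₁ hs₂,
    ← integral_neg_eq_self (fun y => ∫ z, PowerSeries.coeff k (formalIntegrand Φ f₂ f₁ z y)
        * metricDet Φ z * Complex.exp (-metricForm Φ z y))]
  refine congrArg _ (integral_congr_ae (.of_forall fun y => ?_))
  set φ : smoothAlg n := ⟨_, contDiff_ofReal_comp hΦ⟩ with hφ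
  set d : smoothAlg n := ⟨_, contDiff_metricDet hΦ⟩ with hd
  set g₁ : smoothAlg n := ⟨f₁, hf₁⟩ with hg₁
  set g₂ : smoothAlg n := ⟨f₂, hf₂⟩ with hg₂
  have hval : ∀ (a b : smoothAlg n) (z y : Fin n → ℂ),
      PowerSeries.coeff k (formalIntegrand Φ a b z y) * metricDet Φ z
          * Complex.exp (-metricForm Φ z y)
        = evalAt z (PowerSeries.coeff k (integrandSeries (wirtinger y 0)
          (wirtinger 0 (star y)) φ d a b
          * PowerSeries.C (expForm φ y) * PowerSeries.C d)) := by
    intro a b z y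
    rw [formalIntegrand_eq_map Φ φ d a b rfl rfl, PowerSeries.coeff_map, PowerSeries.coeff_mul_C,
      PowerSeries.coeff_mul_C, map_mul, map_mul, mul_right_comm, ← evalAt_formFn Φ φ rfl]
    simp only [← map_neg]
    rfl
  have h12 := hval g₁ g₂
  have h21 := hval g₂ g₁
  change ∀ z y, PowerSeries.coeff k (formalIntegrand Φ f₁ f₂ z y) * _ * _ = _ at h12
  change ∀ z y, PowerSeries.coeff k (formalIntegrand Φ f₂ f₁ z y) * _ * _ = _ at h21
  simp only [h12, h21]
  exact integral_integrandSeries_swap hs₂ φ d g₁ (mem_supportedIdeal_tsupport g₂) y k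

theorem bullet_mem {Φ : (Fin n → ℂ) → ℝ} (hΦ : ContDiff ℝ ∞ Φ)
    (hpos : ∀ z, (metricMatrix Φ z).PosDef) {f₁ f₂ : PowerSeries ((Fin n → ℂ) → ℂ)}
    (hf₁ : f₁ ∈ compactlySupportedSeries n) (hf₂ : f₂ ∈ compactlySupportedSeries n) :
    bullet Φ f₁ f₂ ∈ compactlySupportedSeries n := by
  have hsum : ∀ {ι : Type} (s : Finset ι) (F : ι → (Fin n → ℂ) → ℂ),
      (∀ i ∈ s, ContDiff ℝ ∞ (F i) ∧ HasCompactSupport (F i)) →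
      ContDiff ℝ ∞ (∑ i ∈ s, F i) ∧ HasCompactSupport (∑ i ∈ s, F i) := by
    intro ι s F h
    refine Finset.sum_induction F (fun f => ContDiff ℝ ∞ f ∧ HasCompactSupport f)
      (fun f g hf hg => ⟨hf.1.add hg.1, hf.2.add hg.2⟩) ⟨contDiff_const, .zero⟩ h
  intro k
  rw [bullet, PowerSeries.coeff_mk]
  exact hsum _ _ fun p _ => hsum _ _ fun q _ =>
    ⟨contDiff_laplaceCoeff hΦ hpos (hf₁ _).1 (hf₂ _).1 _,
      hasCompactSupport_laplaceCoeff hΦ (hf₁ _).1 (hf₂ _).1 (hf₁ _).2 _⟩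

theorem tau_bullet_comm {Φ : (Fin n → ℂ) → ℝ} (hΦ : ContDiff ℝ ∞ Φ)
    (hpos : ∀ z, (metricMatrix Φ z).PosDef) {f₁ f₂ : PowerSeries ((Fin n → ℂ) → ℂ)}
    (hf₁ : f₁ ∈ compactlySupportedSeries n) (hf₂ : f₂ ∈ compactlySupportedSeries n) :
    tau Φ (bullet Φ f₁ f₂) = tau Φ (bullet Φ f₂ f₁) := by
  have hexpand : ∀ {f₁ f₂ : PowerSeries ((Fin n → ℂ) → ℂ)} (_ : f₁ ∈ compactlySupportedSeries n)
      (_ : f₂ ∈ compactlySupportedSeries n) (k : ℕ),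
      ∫ z, PowerSeries.coeff k (bullet Φ f₁ f₂) z * metricDet Φ z
        = ∑ p ∈ Finset.HasAntidiagonal.antidiagonal k,
            ∑ q ∈ Finset.HasAntidiagonal.antidiagonal p.1,
          ∫ z, laplaceCoeff Φ (2 * p.2) (PowerSeries.coeff q.1 f₁) (PowerSeries.coeff q.2 f₂) z
            * metricDet Φ z := by
    intro f₁ f₂ hf₁ hf₂ k
    have hi : ∀ a b c, Integrable fun z =>
        laplaceCoeff Φ c (PowerSeries.coeff a f₁) (PowerSeries.coeff b f₂) z * metricDet Φ z := by
      intro a b c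
      refine Continuous.integrable_of_hasCompactSupport ?_ ?_
      · exact (contDiff_laplaceCoeff hΦ hpos (hf₁ _).1 (hf₂ _).1 _).continuous.mul
          (contDiff_metricDet hΦ).continuous
      · exact (hasCompactSupport_laplaceCoeff hΦ (hf₁ _).1 (hf₂ _).1 (hf₁ _).2 _).mul_right
    simp only [bullet, PowerSeries.coeff_mk, Finset.sum_apply, Finset.sum_mul]
    rw [integral_finsetSum _ fun p _ => integrable_finsetSum _ fun q _ => hi _ _ _]
    exact Finset.sum_congr rfl fun p _ => integral_finsetSum _ fun q _ => hi _ _ _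
  suffices hcoeff : (fun k => ∫ z, PowerSeries.coeff k (bullet Φ f₁ f₂) z * metricDet Φ z)
      = fun k => ∫ z, PowerSeries.coeff k (bullet Φ f₂ f₁) z * metricDet Φ z by
    rw [tau, tau, hcoeff]
  funext k
  rw [hexpand hf₁ hf₂, hexpand hf₂ hf₁]
  refine Finset.sum_congr rfl fun p _ => ?_
  rw [← Finset.Nat.sum_antidiagonal_swap]
  exact Finset.sum_congr rfl fun q _ =>
    integral_laplaceCoeff_comm hΦ hpos (hf₁ _).1 (hf₂ _).1 (hf₁ _).2 (hf₂ _).2 _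

end CyclicInvariance

end KahlerStar

end

theorem proposition3p10 {n : ℕ} (Φ : (Fin n → ℂ) → ℝ) (hΦ : ContDiff ℝ ∞ Φ)
    (hpos : ∀ z, (KahlerStar.metricMatrix Φ z).PosDef)
    (f₁ f₂ : PowerSeries ((Fin n → ℂ) → ℂ))
    (hf₁ : f₁ ∈ KahlerStar.compactlySupportedSeries n)
    (hf₂ : f₂ ∈ KahlerStar.compactlySupportedSeries n) :
    KahlerStar.bullet Φ f₁ f₂ ∈ KahlerStar.compactlySupportedSeries n ∧
    KahlerStar.bullet Φ f₂ f₁ ∈ KahlerStar.compactlySupportedSeries n ∧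
    KahlerStar.tau Φ (KahlerStar.bullet Φ f₁ f₂)
      = KahlerStar.tau Φ (KahlerStar.bullet Φ f₂ f₁) :=
  ⟨KahlerStar.bullet_mem hΦ hpos hf₁ hf₂, KahlerStar.bullet_mem hΦ hpos hf₂ hf₁,
    KahlerStar.tau_bullet_comm hΦ hpos hf₁ hf₂⟩
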